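/- Let $G$ be a Polish group and let $H\le G$ be a closed subgroup. The following conventions are used. * For a topological group $\Gamma$, a $\Gamma$-flow is a nonempty compact Hausdorff space $X$ with a (jointly) continuous action $\Gamma\times X\to X$. $P(X)$ denotes the set of regular Borel probability measures on $X$, viewed inside $C(X)^*$ with the weak-* topology and with the push-forward action of $\Gamma$. $X$ is *proximal* if for all $x,y\in X$ there is a net $(g_\lambda)$ in $\Gamma$ such that $\lim g_\lambda x$ and $\lim g_\lambda y$ exist and are equal; $X$ is *strongly proximal* if $P(X)$ is proximal. $\Gamma$ is *amenable* if every strongly proximal $\Gamma$-flow has a $\Gamma$-fixed point. * An affine $G$-flow is a nonempty compact convex subset $K$ of a Hausdorff locally convex real topological vector space with a continuous action of $G$ on $K$ by affine homeomorphisms; affine $G$-maps are the continuous $G$-equivariant affine maps. For a $G$-flow $X$, $P(X)$ is an affine $G$-flow. An affine $G$-flow $K$ is *affine $G$-projective* if for all affine $G$-flows $L,P$, every affine $G$-map $\phi\colon K\to L$ and every surjective affine $G$-map $\pi\colon P\to L$ there is an affine $G$-map $\psi\colon K\to P$ with $\pi\circ\psi=\phi$. * $\operatorname{RUC}^b(G/H)$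 is the commutative unital $C^*$-algebra of bounded functions $f\colon G/H\to\mathbb C$ such that for every $\varepsilon>0$ there is a neighbourhood $U$ of $1_G$ with $|f(ux)-f(x)|<\varepsilon$ for all $u\in U$ and $x\in G/H$, with the action $(g\cdot f)(x)=f(g^{-1}x)$. The Samuel compactification $\mathrm{Sa}(G/H)$ is its spectrum, which is a $G$-flow under $(g\cdot p)(f)=p(g^{-1}\cdot f)$. * A function system is a norm closed unital self-adjoint subspace of a unital commutative $C^*$-algebra; a $G$-function system is a function system with a (jointly norm) continuous action of $G$ by unital order isomorphisms (unital linear bijections that preserve positivity in both directions). Morphisms are the $G$-equivariant unital positive linear maps. A $G$-function system $R$ is *injective* if for all $G$-function systems $E_1, E_2$, every $G$-equivariant unital linear order embedding $\iota\colon E_1\to E_2$ (that is, $x\ge 0\iff\iota(x)\ge 0$) and every morphism $\phi\colon E_1\to R$ there is a morphism $\psi\colon E_2\to R$ with $\psi\circ\iota=\phi$. Then 1. $H$ is amenable if and only if the affine $G$-flow $P(\mathrm{Sa}(G/H))$ is affine $G$-projective. 2. $H$ is amenable if and only if $\operatorname{RUC}^b(G/H)$ is injective in the category of $G$-function systems with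 $G$-equivariant unital positive maps. -/

import Mathlib

open Filter Topology MeasureTheory Function
open scoped BoundedContinuousFunction

universe u

noncomputable section

/-! ### Affine flows -/

/-- A map between subsets of real vector spaces that preserves convex combinations. The point `z`
is the convex combination `a x + b y`, and it is required to be in the domain. -/
def PreservesConvexComb {E F : Type*} [AddCommGroup E] [Module ℝ E] [AddCommGroup F] [Module ℝ F]
    {K : Set E} {L : Set F} (f : K → L) : Prop :=
  ∀ (x y z : K) (a b : ℝ), 0 ≤ a → 0 ≤ b → a + b = 1 →
    (z : E) = a • (x : E) + b • (y : E) → (f z : F) = a • (f x : F) + b • (f y : F)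

/-- An affine `G`-flow: a (nonempty) compact convex subset of a Hausdorff locally convex real
topological vector space, with a jointly continuous action of `G` by affine homeomorphisms. -/
structure AffineFlow (G : Type u) [Group G] [TopologicalSpace G] : Type (u + 1) where
  E : Type u
  [addCommGroup : AddCommGroup E]
  [module : Module ℝ E]
  [topologicalSpace : TopologicalSpace E]
  [isTopologicalAddGroup : IsTopologicalAddGroup E]
  [continuousSMul : ContinuousSMul ℝ E]
  [locallyConvexSpace : LocallyConvexSpace ℝ E]
  [t2Space : T2Space E]
  carrier : Set E
  nonempty : carrier.Nonempty
  isCompact : IsCompact carrier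
  convex : Convex ℝ carrier
  [action : MulAction G carrier]
  continuous_action : ContinuousSMul G carrier
  affine_action : ∀ g : G, PreservesConvexComb (fun x : carrier => g • x)

attribute [instance] AffineFlow.addCommGroup AffineFlow.module AffineFlow.topologicalSpace
  AffineFlow.isTopologicalAddGroup AffineFlow.continuousSMul AffineFlow.locallyConvexSpace
  AffineFlow.t2Space AffineFlow.action AffineFlow.continuous_action

/-- Affine `G`-maps: continuous, equivariant and affine. -/
structure IsAffineGMap {G : Type u} [Group G] [TopologicalSpace G] (K L : AffineFlow G)
    (f : K.carrier → L.carrier) : Prop where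
  continuous : Continuous f
  equivariant : ∀ (g : G) (x : K.carrier), f (g • x) = g • f x
  affine : PreservesConvexComb f

/-- Affine `G`-projectivity: affine `G`-maps out of `K` lift through affine extensions. -/
def AffineFlow.IsProjective {G : Type u} [Group G] [TopologicalSpace G] (K : AffineFlow G) :
    Prop :=
  ∀ (L P : AffineFlow G) (φ : K.carrier → L.carrier) (π : P.carrier → L.carrier),
    IsAffineGMap K L φ → IsAffineGMap P L π → Surjective π →
      ∃ ψ : K.carrier → P.carrier, IsAffineGMap K P ψ ∧ π ∘ ψ = φ

/-! ### The flow of regular Borel probability measures -/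

section RegProb

/-- `P(X)`, the regular Borel probability measures on `X`, viewed inside `C(X)^*` with its weak-*
topology. -/
def RegProb (X : Type u) [TopologicalSpace X] : Set (WeakDual ℝ C(X, ℝ)) :=
  letI : MeasurableSpace X := borel X
  {Λ | ∃ μ : Measure X, IsProbabilityMeasure μ ∧ μ.Regular ∧ ∀ f : C(X, ℝ), Λ f = ∫ x, f x ∂μ}

variable {X : Type u} [TopologicalSpace X] [CompactSpace X] [T2Space X]

theorem mem_regProb_iff (Λ : WeakDual ℝ C(X, ℝ)) :
    Λ ∈ RegProb X ↔ Λ 1 = 1 ∧ ∀ f : C(X, ℝ), 0 ≤ f → 0 ≤ Λ f := by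
  let _ : MeasurableSpace X := borel X
  have _ : BorelSpace X := ⟨rfl⟩
  constructor
  · rintro ⟨μ, hμ, -, h⟩
    refine ⟨by simp [h], fun f hf => ?_⟩
    rw [h]
    exact integral_nonneg fun x => hf x
  · rintro ⟨h1, hpos⟩
    let T : CompactlySupportedContinuousMap X ℝ →ₗ[ℝ] ℝ :=
      { toFun := fun f => Λ (f : C(X, ℝ))
        map_add' := fun f g => map_add Λ (f : C(X, ℝ)) (g : C(X, ℝ))
        map_smul' := fun c f => map_smul Λ c (f : C(X, ℝ)) }
    let T' : CompactlySupportedContinuousMap X ℝ →ₚ[ℝ] ℝ :=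
      PositiveLinearMap.mk₀ T fun f hf => hpos _ hf
    have key : ∀ f : C(X, ℝ), Λ f = ∫ x, f x ∂(RealRMK.rieszMeasure T') := fun f =>
      (RealRMK.integral_rieszMeasure T'
        (CompactlySupportedContinuousMap.continuousMapEquiv f)).symm
    refine ⟨RealRMK.rieszMeasure T', ⟨?_⟩, inferInstance, key⟩
    have := key 1
    rw [h1] at this
    simp only [ContinuousMap.one_apply, integral_const, smul_eq_mul, mul_one] at this
    have h2 : (RealRMK.rieszMeasure T').real Set.univ = 1 := this.symm
    rwa [measureReal_def, ENNReal.toReal_eq_one_iff] at h2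

theorem regProb_norm_le {Λ : WeakDual ℝ C(X, ℝ)} (h : Λ ∈ RegProb X) (f : C(X, ℝ)) :
    ‖Λ f‖ ≤ ‖f‖ := by
  obtain ⟨h1, hpos⟩ := (mem_regProb_iff Λ).1 h
  have hb : ∀ x, |f x| ≤ ‖f‖ := fun x => f.norm_coe_le_norm x
  have e1 := hpos (‖f‖ • (1 : C(X, ℝ)) - f) fun x => by
    simpa using (abs_le.1 (hb x)).2
  have e2 := hpos (‖f‖ • (1 : C(X, ℝ)) + f) fun x => by
    have := (abs_le.1 (hb x)).1
    simp; linarith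
  rw [map_sub, map_smul, h1] at e1
  rw [map_add, map_smul, h1] at e2
  simp only [smul_eq_mul, mul_one] at e1 e2
  rw [Real.norm_eq_abs, abs_le]
  constructor <;> linarith

theorem regProb_convex : Convex ℝ (RegProb X) := by
  intro Λ hΛ Λ' hΛ' a b ha hb hab
  rw [mem_regProb_iff] at hΛ hΛ' ⊢
  refine ⟨?_, fun f hf => ?_⟩
  · change a • Λ 1 + b • Λ' 1 = 1
    rw [hΛ.1, hΛ'.1]; simpa using hab
  · change 0 ≤ a • Λ f + b • Λ' f
    have h1 := hΛ.2 f hf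
    have h2 := hΛ'.2 f hf
    simp only [smul_eq_mul]
    positivity

theorem regProb_isCompact : IsCompact (RegProb X) := by
  refine (WeakDual.isCompact_closedBall (𝕜 := ℝ) (E := C(X, ℝ)) 0 1).of_isClosed_subset ?_ ?_
  · have : RegProb X = {Λ | Λ 1 = 1} ∩ ⋂ (f : C(X, ℝ)) (_ : 0 ≤ f), {Λ | 0 ≤ Λ f} := by
      ext Λ
      simp [mem_regProb_iff]
    rw [this]
    refine (isClosed_eq (WeakDual.eval_continuous _) continuous_const).inter ?_
    exact isClosed_iInter fun f => isClosed_iInter fun _ =>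
      isClosed_le continuous_const (WeakDual.eval_continuous _)
  · intro Λ hΛ
    simp only [Set.mem_preimage, mem_closedBall_zero_iff]
    refine ContinuousLinearMap.opNorm_le_bound _ zero_le_one fun f => ?_
    rw [one_mul]
    exact regProb_norm_le hΛ f

theorem regProb_nonempty [Nonempty X] : (RegProb X).Nonempty := by
  obtain ⟨x⟩ := ‹Nonempty X›
  refine ⟨ContinuousMap.evalCLM ℝ x, (mem_regProb_iff _).2 ⟨?_, fun f hf => ?_⟩⟩
  · change (1 : C(X, ℝ)) x = 1
    simp
  · exact hf x

variable {G : Type u} [Group G] [TopologicalSpace G] [MulAction G X] [ContinuousSMul G X]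

/-- Precomposition with the translation by `g`, on `C(X)`. -/
def translateC (g : G) : C(X, ℝ) →L[ℝ] C(X, ℝ) :=
  { toFun := fun f => f.comp ⟨fun x : X => g • x, continuous_const_smul g⟩
    map_add' := fun _ _ => rfl
    map_smul' := fun _ _ => rfl
    cont := ContinuousMap.continuous_precomp _ }

theorem translateC_apply (g : G) (f : C(X, ℝ)) (x : X) : translateC g f x = f (g • x) := rfl

theorem continuous_translateC (f : C(X, ℝ)) : Continuous fun g : G => translateC g f := by
  refine ContinuousMap.continuous_of_continuous_uncurry _ ?_
  exact f.continuous.comp continuous_smul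

/-- The action of `G` on `P(X)` by push-forward: `∫ f d(g • μ) = ∫ f (g • x) dμ(x)`. -/
instance regProbAction : MulAction G (RegProb X) where
  smul g Λ := ⟨(Λ : WeakDual ℝ C(X, ℝ)).comp (translateC g), by
    obtain ⟨h1, hpos⟩ := (mem_regProb_iff _).1 Λ.2
    exact (mem_regProb_iff _).2 ⟨h1, fun f hf => hpos _ fun x => hf (g • x)⟩⟩
  one_smul Λ := by
    refine Subtype.ext (DFunLike.ext _ _ fun f => ?_)
    change (Λ : WeakDual ℝ C(X, ℝ)) (translateC (1 : G) f) = (Λ : WeakDual ℝ C(X, ℝ)) f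
    congr 1; ext x; simp [translateC_apply]
  mul_smul g h Λ := by
    refine Subtype.ext (DFunLike.ext _ _ fun f => ?_)
    change (Λ : WeakDual ℝ C(X, ℝ)) (translateC (g * h) f) =
      (Λ : WeakDual ℝ C(X, ℝ)) (translateC h (translateC g f))
    congr 1; ext x; simp [translateC_apply, mul_smul]

theorem regProb_smul_apply (g : G) (Λ : RegProb X) (f : C(X, ℝ)) :
    ((g • Λ : RegProb X) : WeakDual ℝ C(X, ℝ)) f =
      (Λ : WeakDual ℝ C(X, ℝ)) (translateC g f) := rfl

instance regProb_continuousSMul : ContinuousSMul G (RegProb X) where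
  continuous_smul := by
    refine Continuous.subtype_mk (WeakDual.continuous_of_continuous_eval fun f => ?_) _
    change Continuous fun p : G × RegProb X => (p.2 : WeakDual ℝ C(X, ℝ)) (translateC p.1 f)
    rw [continuous_iff_continuousAt]
    rintro ⟨g₀, Λ₀⟩
    have h1 : Tendsto (fun p : G × RegProb X => (p.2 : WeakDual ℝ C(X, ℝ))
        (translateC p.1 f - translateC g₀ f)) (𝓝 (g₀, Λ₀)) (𝓝 0) := by
      refine squeeze_zero_norm (fun p => regProb_norm_le p.2.2 _) ?_
      have hc : Continuous fun p : G × RegProb X => ‖translateC (X := X) p.1 f - translateC g₀ f‖ :=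
        (((continuous_translateC f).comp continuous_fst).sub continuous_const).norm
      simpa using hc.tendsto (g₀, Λ₀)
    have h2 : Tendsto (fun p : G × RegProb X => (p.2 : WeakDual ℝ C(X, ℝ)) (translateC g₀ f))
        (𝓝 (g₀, Λ₀)) (𝓝 ((Λ₀ : WeakDual ℝ C(X, ℝ)) (translateC g₀ f))) :=
      ((WeakDual.eval_continuous _).comp (continuous_subtype_val.comp continuous_snd)).tendsto _
    have h3 := h1.add h2
    simpa [ContinuousAt] using h3

/-- The affine `G`-flow `P(X)` of a (nonempty) `G`-flow `X`. -/
def probFlow (G : Type u) [Group G] [TopologicalSpace G] (X : Type u) [TopologicalSpace X]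
    [CompactSpace X] [T2Space X] [Nonempty X] [MulAction G X] [ContinuousSMul G X] :
    AffineFlow G where
  E := WeakDual ℝ C(X, ℝ)
  locallyConvexSpace :=
    inferInstanceAs (LocallyConvexSpace ℝ (WeakBilin (topDualPairing ℝ C(X, ℝ))))
  carrier := RegProb X
  nonempty := regProb_nonempty
  isCompact := regProb_isCompact
  convex := regProb_convex
  continuous_action := inferInstance
  affine_action := by
    intro g x y z a b _ _ _ h
    refine DFunLike.ext _ _ fun f => ?_
    change (z : WeakDual ℝ C(X, ℝ)) (translateC g f) =
      a • (x : WeakDual ℝ C(X, ℝ)) (translateC g f) + b • (y : WeakDual ℝ C(X, ℝ)) (translateC g f)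
    rw [h]; rfl

end RegProb

/-! ### Amenability -/

/-- A flow is proximal if any two points `x`, `y` satisfy `lim g_λ x = lim g_λ y` for some net
`(g_λ)` in `G` (here: along some proper filter on `G`). -/
def IsProximalFlow (G X : Type*) [TopologicalSpace X] [SMul G X] : Prop :=
  ∀ x y : X, ∃ F : Filter G, F.NeBot ∧ ∃ z : X,
    Tendsto (fun g => g • x) F (𝓝 z) ∧ Tendsto (fun g => g • y) F (𝓝 z)

/-- A flow `X` is strongly proximal if `P(X)` is proximal. -/
def IsStronglyProximalFlow (G X : Type u) [Group G] [TopologicalSpace G] [TopologicalSpace X]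
    [CompactSpace X] [T2Space X] [MulAction G X] [ContinuousSMul G X] : Prop :=
  IsProximalFlow G (RegProb X)

/-- A topological group is amenable if each strongly proximal flow has a fixed point. -/
def IsAmenableTopGroup (G : Type u) [Group G] [TopologicalSpace G] : Prop :=
  ∀ (X : Type u) [TopologicalSpace X] [CompactSpace X] [T2Space X] [Nonempty X]
    [MulAction G X] [ContinuousSMul G X],
    IsStronglyProximalFlow G X → ∃ x : X, ∀ g : G, g • x = x

/-! ### Function systems -/

/-- Positivity in a C⋆-algebra. -/
def CStarPos {A : Type*} [CommCStarAlgebra A] (x : A) : Prop := ∃ a : A, x = star a * a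

/-- A `G`-function system: a norm closed unital self-adjoint subspace of a unital commutative
C⋆-algebra, with a jointly (norm) continuous action of `G` by unital order isomorphisms. -/
structure GFunctionSystem (G : Type u) [Group G] [TopologicalSpace G] : Type (u + 1) where
  A : Type u
  [commCStarAlgebra : CommCStarAlgebra A]
  carrier : Submodule ℂ A
  isClosed : IsClosed (carrier : Set A)
  one_mem : (1 : A) ∈ carrier
  star_mem : ∀ x ∈ carrier, star x ∈ carrier
  ρ : Representation ℂ G carrier
  map_one : ∀ g : G, (ρ g ⟨1, one_mem⟩ : A) = 1
  pos_iff : ∀ (g : G) (x : carrier), CStarPos (x : A) ↔ CStarPos (ρ g x : A)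
  continuous_action : Continuous fun p : G × carrier => ρ p.1 p.2

attribute [instance] GFunctionSystem.commCStarAlgebra

/-- `G`-equivariant unital positive maps. -/
structure IsGUnitalPositive {G : Type u} [Group G] [TopologicalSpace G]
    (E₁ E₂ : GFunctionSystem G) (φ : E₁.carrier →ₗ[ℂ] E₂.carrier) : Prop where
  map_one : (φ ⟨1, E₁.one_mem⟩ : E₂.A) = 1
  pos : ∀ x : E₁.carrier, CStarPos (x : E₁.A) → CStarPos (φ x : E₂.A)
  equivariant : ∀ (g : G) (x : E₁.carrier), φ (E₁.ρ g x) = E₂.ρ g (φ x)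

/-- `R` is injective among `G`-function systems: whenever `E₁` sits inside `E₂` (through an
equivariant unital order embedding `ι`), every morphism `E₁ → R` extends to `E₂`. -/
def GFunctionSystem.IsInjective {G : Type u} [Group G] [TopologicalSpace G]
    (R : GFunctionSystem G) : Prop :=
  ∀ (E₁ E₂ : GFunctionSystem G) (ι : E₁.carrier →ₗ[ℂ] E₂.carrier)
    (φ : E₁.carrier →ₗ[ℂ] R.carrier),
    IsGUnitalPositive E₁ E₂ ι →
    (∀ x : E₁.carrier, CStarPos (ι x : E₂.A) → CStarPos (x : E₁.A)) →
    IsGUnitalPositive E₁ R φ →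
      ∃ ψ : E₂.carrier →ₗ[ℂ] R.carrier, IsGUnitalPositive E₂ R ψ ∧ ψ ∘ₗ ι = φ

/-! ### Right uniformly continuous functions and the Samuel compactification -/

section RUC

variable {G : Type u} [Group G] [TopologicalSpace G] [IsTopologicalGroup G]

/-- Right uniform continuity on `G/H`: for all `ε > 0` there is a neighbourhood `U` of `1` such that
`|f (u x) - f x| < ε` for all `u ∈ U` and `x ∈ G/H`. -/
def IsRUC (H : Subgroup G) (f : G ⧸ H → ℂ) : Prop :=
  ∀ ε > 0, ∃ U ∈ 𝓝 (1 : G), ∀ u ∈ U, ∀ x : G ⧸ H, ‖f (u • x) - f x‖ < ε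

theorem IsRUC.translate {H : Subgroup G} {f : G ⧸ H → ℂ} (hf : IsRUC H f) (g : G) :
    IsRUC H fun x => f (g • x) := by
  intro ε hε
  obtain ⟨U, hU, h⟩ := hf ε hε
  have hc : Tendsto (fun u : G => g * u * g⁻¹) (𝓝 1) (𝓝 1) := by
    have : Continuous fun u : G => g * u * g⁻¹ := by fun_prop
    simpa using this.tendsto 1
  refine ⟨_, hc hU, fun u hu x => ?_⟩
  have := h _ hu (g • x)
  simpa [smul_smul, mul_assoc] using this

/-- `RUC^b(G/H)` as a unital C⋆-algebra of bounded functions (right uniformly continuous functions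
on `G/H` being automatically continuous). -/
def RUCb (H : Subgroup G) : StarSubalgebra ℂ ((G ⧸ H) →ᵇ ℂ) where
  carrier := {f | IsRUC H f}
  algebraMap_mem' c ε hε := ⟨Set.univ, univ_mem, fun u _ x => by simpa using hε⟩
  add_mem' := by
    intro f g hf hg ε hε
    obtain ⟨U, hU, h⟩ := hf (ε / 2) (half_pos hε)
    obtain ⟨V, hV, h'⟩ := hg (ε / 2) (half_pos hε)
    refine ⟨U ∩ V, inter_mem hU hV, fun u hu x => ?_⟩
    have h1 := h u hu.1 x
    have h2 := h' u hu.2 x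
    calc ‖(f + g) (u • x) - (f + g) x‖
        = ‖(f (u • x) - f x) + (g (u • x) - g x)‖ := by
          congr 1; simp only [BoundedContinuousFunction.coe_add, Pi.add_apply]; ring
      _ ≤ ‖f (u • x) - f x‖ + ‖g (u • x) - g x‖ := norm_add_le _ _
      _ < ε := by linarith
  mul_mem' := by
    intro f g hf hg ε hε
    have hM : 0 < ‖f‖ + ‖g‖ + 1 := by positivity
    obtain ⟨U, hU, h⟩ := hf (ε / (‖f‖ + ‖g‖ + 1)) (by positivity)
    obtain ⟨V, hV, h'⟩ := hg (ε / (‖f‖ + ‖g‖ + 1)) (by positivity)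
    refine ⟨U ∩ V, inter_mem hU hV, fun u hu x => ?_⟩
    have h1 := (h u hu.1 x).le
    have h2 := (h' u hu.2 x).le
    calc ‖(f * g) (u • x) - (f * g) x‖
        = ‖f (u • x) * (g (u • x) - g x) + (f (u • x) - f x) * g x‖ := by
          congr 1; simp only [BoundedContinuousFunction.coe_mul, Pi.mul_apply]; ring
      _ ≤ ‖f (u • x)‖ * ‖g (u • x) - g x‖ + ‖f (u • x) - f x‖ * ‖g x‖ := by
          refine (norm_add_le _ _).trans ?_
          rw [norm_mul, norm_mul]
      _ ≤ ‖f‖ * (ε / (‖f‖ + ‖g‖ + 1)) + (ε / (‖f‖ + ‖g‖ + 1)) * ‖g‖ := by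
          have := f.norm_coe_le_norm (u • x)
          have := g.norm_coe_le_norm x
          gcongr
      _ < ε := by
          have : ‖f‖ * (ε / (‖f‖ + ‖g‖ + 1)) + (ε / (‖f‖ + ‖g‖ + 1)) * ‖g‖
              = ε * ((‖f‖ + ‖g‖) / (‖f‖ + ‖g‖ + 1)) := by ring
          rw [this]
          have h3 : (‖f‖ + ‖g‖) / (‖f‖ + ‖g‖ + 1) < 1 := by
            rw [div_lt_one hM]; linarith
          nlinarith
  star_mem' := by
    intro f hf ε hε
    obtain ⟨U, hU, h⟩ := hf ε hε
    refine ⟨U, hU, fun u hu x => ?_⟩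
    have := h u hu x
    rw [← norm_star, star_sub] at this
    simpa using this

instance RUCb_isClosed (H : Subgroup G) : IsClosed (RUCb H : Set ((G ⧸ H) →ᵇ ℂ)) := by
  refine isClosed_of_closure_subset fun f hf ε hε => ?_
  obtain ⟨g, hg, hfg⟩ := Metric.mem_closure_iff.1 hf (ε / 3) (by positivity)
  obtain ⟨U, hU, h⟩ := hg (ε / 3) (by positivity)
  refine ⟨U, hU, fun u hu x => ?_⟩
  have h1 := h u hu x
  have h2 : ‖f (u • x) - g (u • x)‖ < ε / 3 := by
    rw [← dist_eq_norm]; exact (BoundedContinuousFunction.dist_coe_le_dist _).trans_lt hfg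
  have h3 : ‖g x - f x‖ < ε / 3 := by
    rw [← dist_eq_norm, dist_comm]; exact (BoundedContinuousFunction.dist_coe_le_dist _).trans_lt hfg
  calc ‖f (u • x) - f x‖
      = ‖(f (u • x) - g (u • x)) + (g (u • x) - g x) + (g x - f x)‖ := by congr 1; ring
    _ ≤ _ := norm_add₃_le
    _ < ε := by linarith

/-- The map `f ↦ (x ↦ f (g⁻¹ x))` on bounded functions. -/
def translateB (H : Subgroup G) (g : G) (f : (G ⧸ H) →ᵇ ℂ) : (G ⧸ H) →ᵇ ℂ :=
  f.compContinuous ⟨fun x => g⁻¹ • x, continuous_const_smul g⁻¹⟩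

theorem translateB_apply (H : Subgroup G) (g : G) (f : (G ⧸ H) →ᵇ ℂ) (x : G ⧸ H) :
    translateB H g f x = f (g⁻¹ • x) := rfl

/-- The action of `G` on `RUC^b(G/H)`: `(g f)(x) = f (g⁻¹ x)`. -/
def rucAction (H : Subgroup G) (g : G) : RUCb H →⋆ₐ[ℂ] RUCb H where
  toFun f := ⟨translateB H g f, IsRUC.translate f.2 g⁻¹⟩
  map_one' := rfl
  map_mul' _ _ := rfl
  map_zero' := rfl
  map_add' _ _ := rfl
  commutes' _ := rfl
  map_star' _ := rfl

theorem rucAction_apply (H : Subgroup G) (g : G) (f : RUCb H) (x : G ⧸ H) :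
    (rucAction H g f : (G ⧸ H) →ᵇ ℂ) x = (f : (G ⧸ H) →ᵇ ℂ) (g⁻¹ • x) := rfl

theorem rucAction_one (H : Subgroup G) (f : RUCb H) : rucAction H 1 f = f := by
  ext x; simp [rucAction_apply]

theorem rucAction_mul (H : Subgroup G) (g h : G) (f : RUCb H) :
    rucAction H (g * h) f = rucAction H g (rucAction H h f) := by
  ext x; simp [rucAction_apply, mul_smul]

theorem norm_rucAction_le (H : Subgroup G) (g : G) (f : RUCb H) : ‖rucAction H g f‖ ≤ ‖f‖ :=
  (BoundedContinuousFunction.norm_le (norm_nonneg _)).2 fun x =>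
    (f : (G ⧸ H) →ᵇ ℂ).norm_coe_le_norm (g⁻¹ • x)

theorem continuous_rucAction (H : Subgroup G) :
    Continuous fun p : G × RUCb H => rucAction H p.1 p.2 := by
  rw [continuous_iff_continuousAt]
  rintro ⟨g₀, f₀⟩
  rw [ContinuousAt, tendsto_iff_norm_sub_tendsto_zero]
  have key : Tendsto (fun p : G × RUCb H => ‖rucAction H (g₀⁻¹ * p.1) f₀ - f₀‖)
      (𝓝 (g₀, f₀)) (𝓝 0) := by
    rw [Metric.tendsto_nhds]
    intro ε hε
    obtain ⟨U, hU, h⟩ := f₀.2 (ε / 2) (half_pos hε)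
    have hc : Tendsto (fun p : G × RUCb H => (g₀⁻¹ * p.1)⁻¹) (𝓝 (g₀, f₀)) (𝓝 1) := by
      have : Continuous fun p : G × RUCb H => (g₀⁻¹ * p.1)⁻¹ := by fun_prop
      simpa using this.tendsto (g₀, f₀)
    filter_upwards [hc hU] with p hp
    have : ‖rucAction H (g₀⁻¹ * p.1) f₀ - f₀‖ ≤ ε / 2 :=
      (BoundedContinuousFunction.norm_le (half_pos hε).le).2 fun x => (h _ hp x).le
    rw [Real.dist_eq, sub_zero, abs_of_nonneg (norm_nonneg _)]
    linarith
  have key2 : Tendsto (fun p : G × RUCb H => ‖p.2 - f₀‖) (𝓝 (g₀, f₀)) (𝓝 0) := by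
    have : Continuous fun p : G × RUCb H => ‖p.2 - f₀‖ := by fun_prop
    simpa using this.tendsto (g₀, f₀)
  refine squeeze_zero (fun _ => norm_nonneg _) (fun p => ?_) (by simpa using key2.add key)
  have e : rucAction H p.1 p.2 - rucAction H g₀ f₀ =
      rucAction H p.1 (p.2 - f₀) + rucAction H g₀ (rucAction H (g₀⁻¹ * p.1) f₀ - f₀) := by
    rw [map_sub, map_sub, ← rucAction_mul, mul_inv_cancel_left]
    abel
  calc ‖rucAction H p.1 p.2 - rucAction H g₀ f₀‖
      ≤ ‖rucAction H p.1 (p.2 - f₀)‖ + ‖rucAction H g₀ (rucAction H (g₀⁻¹ * p.1) f₀ - f₀)‖ := by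
        rw [e]; exact norm_add_le _ _
    _ ≤ _ := add_le_add (norm_rucAction_le H _ _) (norm_rucAction_le H _ _)

/-- `RUC^b(G/H)` as a `G`-function system. -/
def rucSystem (H : Subgroup G) : GFunctionSystem G where
  A := (G ⧸ H) →ᵇ ℂ
  carrier := Subalgebra.toSubmodule (RUCb H).toSubalgebra
  isClosed := RUCb_isClosed H
  one_mem := one_mem (RUCb H)
  star_mem := fun _ hx => star_mem (s := RUCb H) hx
  ρ :=
    { toFun := fun g => ((rucAction H g : RUCb H →⋆ₐ[ℂ] RUCb H) : RUCb H →ₐ[ℂ] RUCb H).toLinearMap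
      map_one' := LinearMap.ext fun f => rucAction_one H f
      map_mul' := fun g h => LinearMap.ext fun f => rucAction_mul H g h f }
  map_one := fun _ => rfl
  pos_iff := by
    intro g x
    constructor
    · rintro ⟨a, ha⟩
      refine ⟨translateB H g a, ?_⟩
      change translateB H g x = _
      rw [ha]; rfl
    · rintro ⟨a, ha⟩
      refine ⟨translateB H g⁻¹ a, ?_⟩
      change translateB H g x = _ at ha
      have : translateB H g⁻¹ (translateB H g x) = x := by
        ext y; simp [translateB_apply]
      rw [← this, ha]; rfl
  continuous_action := continuous_rucAction H

/-- The Samuel compactification `Sa(G/H)`, the spectrum of `RUC^b(G/H)`. -/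
abbrev Sa (H : Subgroup G) : Type u := WeakDual.characterSpace ℂ (RUCb H)

/-- The canonical image of a point of `G/H` in `Sa(G/H)`, evaluation at that point. -/
def Sa.point (H : Subgroup G) (x : G ⧸ H) : Sa H :=
  WeakDual.CharacterSpace.equivAlgHom.symm
    { toFun := fun f => (f : (G ⧸ H) →ᵇ ℂ) x
      map_one' := rfl
      map_mul' := fun _ _ => rfl
      map_zero' := rfl
      map_add' := fun _ _ => rfl
      commutes' := fun _ => rfl }

instance Sa.instNonempty (H : Subgroup G) : Nonempty (Sa H) := ⟨Sa.point H ((1 : G) : G ⧸ H)⟩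

instance Sa.instCompactSpace (H : Subgroup G) : CompactSpace (Sa H) :=
  inferInstanceAs (CompactSpace (WeakDual.characterSpace ℂ (RUCb H)))

/-- The action of `G` on `Sa(G/H)`: `(g p)(f) = p (g⁻¹ f)`. -/
instance Sa.instMulAction (H : Subgroup G) : MulAction G (Sa H) where
  smul g p := WeakDual.CharacterSpace.equivAlgHom.symm
    ((WeakDual.CharacterSpace.toAlgHom p).comp
      ((rucAction H g⁻¹ : RUCb H →⋆ₐ[ℂ] RUCb H) : RUCb H →ₐ[ℂ] RUCb H))
  one_smul p := by
    refine WeakDual.CharacterSpace.ext fun f => ?_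
    change p (rucAction H (1 : G)⁻¹ f) = p f
    rw [inv_one, rucAction_one]
  mul_smul g h p := by
    refine WeakDual.CharacterSpace.ext fun f => ?_
    change p (rucAction H (g * h)⁻¹ f) = p (rucAction H h⁻¹ (rucAction H g⁻¹ f))
    rw [mul_inv_rev, rucAction_mul]

theorem Sa.smul_apply (H : Subgroup G) (g : G) (p : Sa H) (f : RUCb H) :
    (g • p) f = p (rucAction H g⁻¹ f) := rfl

theorem Sa.smul_point (H : Subgroup G) (g : G) (x : G ⧸ H) :
    g • Sa.point H x = Sa.point H (g • x) := by
  refine WeakDual.CharacterSpace.ext fun f => ?_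
  change (f : (G ⧸ H) →ᵇ ℂ) (g⁻¹⁻¹ • x) = (f : (G ⧸ H) →ᵇ ℂ) (g • x)
  rw [inv_inv]

instance Sa.instContinuousSMul (H : Subgroup G) : ContinuousSMul G (Sa H) where
  continuous_smul := by
    refine Continuous.subtype_mk (WeakDual.continuous_of_continuous_eval fun f => ?_) _
    change Continuous fun q : G × Sa H => q.2 (rucAction H q.1⁻¹ f)
    rw [continuous_iff_continuousAt]
    rintro ⟨g₀, p₀⟩
    have h1 : Tendsto (fun q : G × Sa H => q.2 (rucAction H q.1⁻¹ f - rucAction H g₀⁻¹ f))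
        (𝓝 (g₀, p₀)) (𝓝 0) := by
      refine squeeze_zero_norm (fun q => ?_)
        (a := fun q : G × Sa H => ‖rucAction H q.1⁻¹ f - rucAction H g₀⁻¹ f‖) ?_
      · exact spectrum.norm_le_norm_of_mem (WeakDual.CharacterSpace.apply_mem_spectrum q.2 _)
      · have hc : Continuous fun q : G × Sa H => ‖rucAction H q.1⁻¹ f - rucAction H g₀⁻¹ f‖ :=
          (((continuous_rucAction H).comp
            (continuous_fst.inv.prodMk continuous_const)).sub continuous_const).norm
        simpa using hc.tendsto (g₀, p₀)
    have h2 : Tendsto (fun q : G × Sa H => q.2 (rucAction H g₀⁻¹ f))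
        (𝓝 (g₀, p₀)) (𝓝 (p₀ (rucAction H g₀⁻¹ f))) :=
      ((WeakDual.eval_continuous _).comp (continuous_subtype_val.comp continuous_snd)).tendsto _
    have h3 := h1.add h2
    simpa [ContinuousAt] using h3

end RUC

end

/-! # Amenability of a closed subgroup via affine projectivity and injectivity -/

noncomputable section

/-! ### Point masses and barycenters -/

section Barycenter

/-! Both equivalences rest on the same picture. A `G`-equivariant object over `G/H` is determined by
its value at the base point `o = H`, and that value can be any `H`-invariant one. Amenability of `H`
is what makes such values available.

From amenability to lifting and extension. An amenable group fixes a point in every affine flow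
(`AffineFlow.exists_fixed`). Indeed, in a minimal affine flow the closure of the extreme points is
strongly proximal, by Milman's and Bauer's theorems, so it contains a fixed point. For projectivity,
apply this to the fibre of `π` over `φ(δ_o)`. An `H`-fixed point `p` there gives the map `gH ↦ g p`;
its scalar coordinates are right uniformly continuous, so taking barycenters extends it to an affine
`G`-map on `P(Sa(G/H))`. For injectivity, apply it to the positive extensions to `E₂` of the
functional `x ↦ Re φ(x)(o)`. An `H`-invariant extension has a complexification `S`, and `ψ(x)(gH) =
S(g⁻¹ x)` is the required morphism.

From lifting and extension to amenability. Use the quotient `G → G/H`, with `G` written as `G ⧸ ⊥`.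
Projectivity splits the affine map `P(Sa(G)) → P(Sa(G/H))`, and injectivity splits the inclusion of
`RUC^b(G/H)` in `RUC^b(G)`. The value of the splitting at `o` is in both cases an `H`-invariant mean
on `RUC^b(G)` that restricts to evaluation at `o` on functions coming from `G/H`. Such a mean is
concentrated near `H`, so it descends to an invariant mean on the right uniformly continuous
functions on `H` (`isAmenableTopGroup_of_mean_over_point`). An invariant mean gives every flow an
invariant measure, and in a strongly proximal flow this measure is a point mass
(`isAmenableTopGroup_of_mean`).

Metrizability enters in this second half only: a metric for the right uniformity yields bump
functions around `H` and approximate extensions of functions from `H` to `G`. -/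

theorem WeakDual.exists_eval_eq {V : Type*} [NormedAddCommGroup V] [NormedSpace ℝ V]
    (Φ : StrongDual ℝ (WeakDual ℝ V)) : ∃ v : V, ∀ Λ : WeakDual ℝ V, Φ Λ = Λ v := by
  obtain ⟨v, hv⟩ := LinearMap.dualEmbedding_surjective (topDualPairing ℝ V) Φ
  exact ⟨v, fun Λ => by rw [← hv]; rfl⟩

variable {X : Type u} [TopologicalSpace X] [CompactSpace X] [T2Space X]

/-- The point mass at `x`. -/
def pointMass (x : X) : RegProb X :=
  ⟨ContinuousMap.evalCLM ℝ x, (mem_regProb_iff _).2 ⟨rfl, fun _ hf => hf x⟩⟩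

theorem pointMass_apply (x : X) (f : C(X, ℝ)) :
    (pointMass x : WeakDual ℝ C(X, ℝ)) f = f x := rfl

theorem continuous_pointMass : Continuous (pointMass : X → RegProb X) :=
  Continuous.subtype_mk (WeakDual.continuous_of_continuous_eval fun f => f.continuous) _

theorem pointMass_injective : Injective (pointMass : X → RegProb X) := by
  intro x y h
  by_contra hxy
  obtain ⟨f, hf0, hf1, -⟩ := exists_continuous_zero_one_of_isClosed
    (isClosed_singleton (x := x)) (isClosed_singleton (x := y))
    (Set.disjoint_singleton.2 hxy)
  have h2 : f x = f y := by rw [← pointMass_apply, h, pointMass_apply]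
  rw [hf0 rfl, hf1 rfl] at h2
  simp at h2

theorem smul_pointMass {G : Type u} [Group G] [TopologicalSpace G] [MulAction G X]
    [ContinuousSMul G X] (g : G) (x : X) : g • pointMass x = pointMass (g • x) := rfl

theorem regProb_mono (Λ : RegProb X) {f g : C(X, ℝ)} (h : f ≤ g) :
    (Λ : WeakDual ℝ C(X, ℝ)) f ≤ (Λ : WeakDual ℝ C(X, ℝ)) g := by
  have := ((mem_regProb_iff _).1 Λ.2).2 (g - f) (sub_nonneg.2 h)
  rw [map_sub] at this
  linarith

theorem regProb_one (Λ : RegProb X) : (Λ : WeakDual ℝ C(X, ℝ)) 1 = 1 :=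
  ((mem_regProb_iff _).1 Λ.2).1

/-- A closed convex set that contains the point masses of a dense set of points contains all
regular probability measures. -/
theorem regProb_subset_of_pointMass_mem {D : Type*} {j : D → X} (hj : DenseRange j)
    {T : Set (WeakDual ℝ C(X, ℝ))} (hT : IsClosed T) (hTc : Convex ℝ T)
    (h : ∀ d, (pointMass (j d) : WeakDual ℝ C(X, ℝ)) ∈ T) : RegProb X ⊆ T := by
  intro Λ hΛ
  by_contra hn
  have : LocallyConvexSpace ℝ (WeakDual ℝ C(X, ℝ)) :=
    inferInstanceAs (LocallyConvexSpace ℝ (WeakBilin (topDualPairing ℝ C(X, ℝ))))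
  -- A weak-* continuous functional separating `Λ` from `T` is evaluation at some `f`. Then `f ≥ s`
  -- on a dense set, hence everywhere, and positivity of `Λ` contradicts `Λ f < s`.
  obtain ⟨Φ, s, h1, h2⟩ := geometric_hahn_banach_point_closed hTc hT hn
  obtain ⟨f, hf⟩ := WeakDual.exists_eval_eq Φ
  have h3 : ∀ x, s ≤ f x := by
    intro x
    refine hj.induction_on (p := fun x => s ≤ f x) x
      (isClosed_le continuous_const f.continuous) fun d => ?_
    have := h2 _ (h d)
    rw [hf] at this
    exact this.le
  have h4 := regProb_mono ⟨Λ, hΛ⟩ (f := s • (1 : C(X, ℝ))) (g := f) fun x => by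
    simpa using h3 x
  rw [map_smul, regProb_one] at h4
  rw [hf] at h1
  simp only [smul_eq_mul, mul_one] at h4
  exact absurd h1 (not_lt.2 h4)

variable {E : Type*} [AddCommGroup E] [Module ℝ E] [TopologicalSpace E]

/-- Two continuous affine maps on `P(X)` that agree at the point masses of a dense set of points
are equal. -/
theorem regProb_map_ext [T2Space E] {D : Type*} {j : D → X} (hj : DenseRange j) {K : Set E}
    {f g : RegProb X → K} (hf : Continuous f) (hg : Continuous g) (hfa : PreservesConvexComb f)
    (hga : PreservesConvexComb g) (h : ∀ d, f (pointMass (j d)) = g (pointMass (j d))) :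
    f = g := by
  have hcl : IsClosed (Subtype.val '' {Λ : RegProb X | f Λ = g Λ}) :=
    regProb_isCompact.isClosed.isClosedEmbedding_subtypeVal.isClosedMap _ (isClosed_eq hf hg)
  have hcv : Convex ℝ (Subtype.val '' {Λ : RegProb X | f Λ = g Λ}) := by
    rintro _ ⟨Λ, hΛ, rfl⟩ _ ⟨Λ', hΛ', rfl⟩ a b ha hb hab
    refine ⟨⟨_, regProb_convex Λ.2 Λ'.2 ha hb hab⟩, Subtype.ext ?_, rfl⟩
    rw [hfa Λ Λ' _ a b ha hb hab rfl, hga Λ Λ' _ a b ha hb hab rfl, hΛ, hΛ']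
  funext Λ
  obtain ⟨Λ', h1, h2⟩ := regProb_subset_of_pointMass_mem hj hcl hcv
    (fun d => ⟨_, h d, rfl⟩) Λ.2
  rwa [← Subtype.ext h2]

variable [IsTopologicalAddGroup E] [ContinuousSMul ℝ E] [LocallyConvexSpace ℝ E] [T2Space E]

theorem eq_of_forall_strongDual_eq {x y : E} (h : ∀ ℓ : StrongDual ℝ E, ℓ x = ℓ y) : x = y := by
  by_contra hxy
  obtain ⟨ℓ, hℓ⟩ := geometric_hahn_banach_point_point hxy
  exact hℓ.ne (h ℓ)

/-- The barycenter map of a map `q` from a dense subset of `X` to a compact convex set, provided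
that each `ℓ ∘ q` extends continuously to `X`. -/
theorem exists_barycenter_map {D : Type*} {j : D → X} (hj : DenseRange j) {K : Set E}
    (hK : IsCompact K) (hKc : Convex ℝ K) (q : D → K) (c : StrongDual ℝ E → C(X, ℝ))
    (hc : ∀ ℓ d, c ℓ (j d) = ℓ (q d)) :
    ∃ b : RegProb X → K, Continuous b ∧ PreservesConvexComb b ∧
      (∀ (Λ : RegProb X) (ℓ : StrongDual ℝ E), ℓ (b Λ : E) = (Λ : WeakDual ℝ C(X, ℝ)) (c ℓ)) ∧
      ∀ d, b (pointMass (j d)) = q d := by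
  -- `S` is the graph of the barycenter map. It is compact and convex, so its projection to `P(X)`
  -- is closed and convex; containing the point masses `δ_{j d}`, it is everything. No vector-valued
  -- integral is needed.
  let S : Set (WeakDual ℝ C(X, ℝ) × E) :=
    (RegProb X ×ˢ K) ∩ {p | ∀ ℓ : StrongDual ℝ E, ℓ p.2 = p.1 (c ℓ)}
  have hS : IsCompact S := by
    refine (regProb_isCompact.prod hK).inter_right ?_
    rw [Set.ofPred_forall]
    exact isClosed_iInter fun ℓ => isClosed_eq (ℓ.continuous.comp continuous_snd)
      ((WeakDual.eval_continuous _).comp continuous_fst)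
  have hSc : Convex ℝ S := by
    refine (regProb_convex.prod hKc).inter ?_
    intro p hp p' hp' a b _ _ _ ℓ
    change ℓ (a • p.2 + b • p'.2) = a • p.1 (c ℓ) + b • p'.1 (c ℓ)
    rw [map_add, map_smul, map_smul, hp ℓ, hp' ℓ]
  have hsub : RegProb X ⊆ Prod.fst '' S := by
    refine regProb_subset_of_pointMass_mem hj (hS.image continuous_fst).isClosed
      (hSc.linear_image (LinearMap.fst ℝ (WeakDual ℝ C(X, ℝ)) E)) fun d => ?_
    exact ⟨(_, (q d : E)), ⟨⟨Subtype.coe_prop _, (q d).2⟩, fun ℓ => (hc ℓ d).symm⟩, rfl⟩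
  have hex : ∀ Λ : RegProb X, ∃ k : K, ∀ ℓ : StrongDual ℝ E,
      ℓ (k : E) = (Λ : WeakDual ℝ C(X, ℝ)) (c ℓ) := by
    intro Λ
    obtain ⟨⟨Λ', k⟩, ⟨⟨-, hk⟩, h⟩, rfl : Λ' = Λ⟩ := hsub Λ.2
    exact ⟨⟨k, hk⟩, h⟩
  choose b hb using hex
  refine ⟨b, ?_, ?_, hb, fun d => Subtype.ext (eq_of_forall_strongDual_eq fun ℓ => ?_)⟩
  -- The functionals `ℓ` embed the compact set `K` in a power of `ℝ`, so continuity can be checked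
  -- after each `ℓ`.
  · have : CompactSpace K := isCompact_iff_compactSpace.1 hK
    let e : K → StrongDual ℝ E → ℝ := fun k ℓ => ℓ (k : E)
    have he : Continuous e := continuous_pi fun ℓ => ℓ.continuous.comp continuous_subtype_val
    have hinj : Injective e := fun x y h =>
      Subtype.ext (eq_of_forall_strongDual_eq fun ℓ => congrFun h ℓ)
    rw [(he.isClosedEmbedding hinj).isInducing.continuous_iff]
    refine continuous_pi fun ℓ => ?_
    simp only [comp_apply, e, hb]
    exact (WeakDual.eval_continuous _).comp continuous_subtype_val
  · intro Λ Λ' Λ'' s t _ _ _ h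
    refine eq_of_forall_strongDual_eq fun ℓ => ?_
    rw [map_add, map_smul, map_smul, hb, hb, hb, h]
    rfl
  · rw [hb, ← hc]; rfl

/-- Bauer's characterization of extreme points: the only measure with barycenter an extreme point
`x` is the point mass at `x`. -/
theorem eq_pointMass_of_barycenter_mem_extremePoints {K : Set E} (hK : IsCompact K)
    (hKc : Convex ℝ K) {q : X → E} (hq : Continuous q) (hinj : Injective q) (hqK : ∀ x, q x ∈ K)
    {x : X} (hx : q x ∈ K.extremePoints ℝ) {Λ : RegProb X}
    (h : ∀ ℓ : StrongDual ℝ E, (Λ : WeakDual ℝ C(X, ℝ)) ⟨fun y => ℓ (q y), by fun_prop⟩ = ℓ (q x)) :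
    Λ = pointMass x := by
  let c : StrongDual ℝ E → C(X, ℝ) := fun ℓ => ⟨fun y => ℓ (q y), by fun_prop⟩
  replace h : ∀ ℓ, (Λ : WeakDual ℝ C(X, ℝ)) (c ℓ) = ℓ (q x) := h
  obtain ⟨b, -, -, hb, -⟩ := exists_barycenter_map (j := (id : X → X)) denseRange_id hK hKc
    (fun y => ⟨q y, hqK y⟩) c fun _ _ => rfl
  -- With `t = Λ f`, the measure `Λ` is the mixture of the probability measures `fΛ/t` and
  -- `(1-f)Λ/(1-t)`. Their barycenters average to the extreme point `q x`, so the first one equals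
  -- `q x`. The bounds on `f` keep `t` strictly between `0` and `1`.
  have key1 : ∀ f : C(X, ℝ), (∀ y, 1 / 4 ≤ f y) → (∀ y, f y ≤ 3 / 4) → ∀ ℓ,
      (Λ : WeakDual ℝ C(X, ℝ)) (f * c ℓ) = (Λ : WeakDual ℝ C(X, ℝ)) f * ℓ (q x) := by
    intro f hf1 hf2 ℓ
    have aux : ∀ f : C(X, ℝ), (∀ y, 0 ≤ f y) → ∀ t : ℝ, 0 < t →
        (Λ : WeakDual ℝ C(X, ℝ)) f = t → ∃ k ∈ K, ∀ ℓ : StrongDual ℝ E,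
          (Λ : WeakDual ℝ C(X, ℝ)) (f * c ℓ) = t * ℓ k := by
      intro f hf t ht hft
      let M : WeakDual ℝ C(X, ℝ) :=
        (t⁻¹ • (Λ : WeakDual ℝ C(X, ℝ)) : C(X, ℝ) →L[ℝ] ℝ).comp (ContinuousLinearMap.mul ℝ _ f)
      have hM : ∀ g, M g = t⁻¹ * (Λ : WeakDual ℝ C(X, ℝ)) (f * g) := fun g => rfl
      have hMm : M ∈ RegProb X := by
        refine (mem_regProb_iff _).2 ⟨?_, fun g hg => ?_⟩
        · rw [hM, mul_one, hft, inv_mul_cancel₀ ht.ne']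
        · rw [hM]
          exact mul_nonneg (inv_nonneg.2 ht.le)
            (((mem_regProb_iff _).1 Λ.2).2 _ fun y => mul_nonneg (hf y) (hg y))
      refine ⟨b ⟨M, hMm⟩, (b _).2, fun ℓ => ?_⟩
      rw [hb, hM, mul_inv_cancel_left₀ ht.ne']
    set t := (Λ : WeakDual ℝ C(X, ℝ)) f with ht
    have ht1 : 1 / 4 ≤ t := by
      have := regProb_mono Λ (f := (1 / 4 : ℝ) • (1 : C(X, ℝ))) (g := f) fun y => by
        simpa using hf1 y
      rw [map_smul, regProb_one] at this
      simpa using this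
    have ht2 : t ≤ 3 / 4 := by
      have := regProb_mono Λ (g := (3 / 4 : ℝ) • (1 : C(X, ℝ))) (f := f) fun y => by
        simpa using hf2 y
      rw [map_smul, regProb_one] at this
      simpa using this
    obtain ⟨k, hk, hk'⟩ := aux f (fun y => by linarith [hf1 y]) t (by linarith) rfl
    obtain ⟨k₂, hk₂, hk₂'⟩ := aux (1 - f) (fun y => by simpa using by linarith [hf2 y]) (1 - t)
      (by linarith) (by rw [map_sub, regProb_one])
    have hxk : t • k + (1 - t) • k₂ = q x := by
      refine eq_of_forall_strongDual_eq fun ℓ => ?_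
      rw [map_add, map_smul, map_smul, smul_eq_mul, smul_eq_mul, ← hk', ← hk₂', ← map_add,
        ← add_mul, add_sub_cancel, one_mul, h]
    have := (mem_extremePoints_iff_left.1 hx).2 k hk k₂ hk₂
      ⟨t, 1 - t, by linarith, by linarith, by ring, hxk⟩
    rw [hk', this]
  have key2 : ∀ (f : C(X, ℝ)) ℓ,
      (Λ : WeakDual ℝ C(X, ℝ)) (f * c ℓ) = (Λ : WeakDual ℝ C(X, ℝ)) f * ℓ (q x) := by
    intro f ℓ
    -- This scaling puts `1/2 + r f` between `1/4` and `3/4`. The identity is linear in `f` and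
    -- holds for constants, so it passes from `1/2 + r f` to `f`.
    set r : ℝ := (4 * (‖f‖ + 1))⁻¹
    have hr : 0 < r := by positivity
    have hr1 : r * ‖f‖ ≤ 1 / 4 := by
      have : r * (4 * (‖f‖ + 1)) = 1 := inv_mul_cancel₀ (by positivity)
      nlinarith
    have hb : ∀ y, |r * f y| ≤ 1 / 4 := fun y => by
      rw [abs_mul, abs_of_pos hr]
      exact (mul_le_mul_of_nonneg_left (f.norm_coe_le_norm y) hr.le).trans hr1
    have := key1 ((1 / 2 : ℝ) • (1 : C(X, ℝ)) + r • f)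
      (fun y => by simpa using by linarith [(abs_le.1 (hb y)).1])
      (fun y => by simpa using by linarith [(abs_le.1 (hb y)).2]) ℓ
    simp only [add_mul, smul_mul_assoc, one_mul, map_add, map_smul, h, regProb_one,
      smul_eq_mul] at this
    have h' : r * (Λ : WeakDual ℝ C(X, ℝ)) (f * c ℓ) =
      r * ((Λ : WeakDual ℝ C(X, ℝ)) f * ℓ (q x)) := by linarith
    exact mul_left_cancel₀ hr.ne' h'
  -- Functions that behave as constants under `Λ`, with value that at `x`. They form a closed
  -- subalgebra containing each `ℓ ∘ q`, which separates points because `q` is injective. By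
  -- Stone–Weierstrass it is all of `C(X)`, and testing against `f = 1` gives `Λ = δ_x`.
  let A : Subalgebra ℝ C(X, ℝ) :=
    { carrier := {g | ∀ f : C(X, ℝ),
        (Λ : WeakDual ℝ C(X, ℝ)) (f * g) = (Λ : WeakDual ℝ C(X, ℝ)) f * g x}
      mul_mem' := fun {g g'} hg hg' f => by
        rw [← mul_assoc, hg' (f * g), hg f, ContinuousMap.mul_apply, mul_assoc]
      add_mem' := fun {g g'} hg hg' f => by
        rw [mul_add, map_add, hg, hg', ContinuousMap.add_apply, mul_add]
      algebraMap_mem' := fun r f => by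
        rw [Algebra.algebraMap_eq_smul_one, mul_smul_comm, mul_one, map_smul]
        simp [mul_comm] }
  have hA : IsClosed (A : Set C(X, ℝ)) := by
    have : (A : Set C(X, ℝ)) = ⋂ f : C(X, ℝ), {g |
        (Λ : WeakDual ℝ C(X, ℝ)) (f * g) = (Λ : WeakDual ℝ C(X, ℝ)) f * g x} := by
      ext g; simp only [Set.mem_iInter]; rfl
    rw [this]
    refine isClosed_iInter fun f => isClosed_eq ?_ ?_
    · exact (map_continuous (Λ : WeakDual ℝ C(X, ℝ))).comp (continuous_const.mul continuous_id)
    · exact continuous_const.mul (continuous_eval_const x)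
  have hsep : A.SeparatesPoints := by
    intro y z hyz
    obtain ⟨ℓ, hℓ⟩ := geometric_hahn_banach_point_point (hinj.ne hyz)
    exact ⟨_, ⟨c ℓ, fun f => key2 f ℓ, rfl⟩, hℓ.ne⟩
  have htop := ContinuousMap.subalgebra_topologicalClosure_eq_top_of_separatesPoints A hsep
  refine Subtype.ext (DFunLike.ext _ _ fun g => ?_)
  have hg : g ∈ A := by
    have : g ∈ A.topologicalClosure := htop ▸ Algebra.mem_top
    rwa [← SetLike.mem_coe, Subalgebra.topologicalClosure_coe, hA.closure_eq] at this
  have := hg 1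
  rw [one_mul, regProb_one, one_mul] at this
  exact this

/-- Milman's converse to the Krein–Milman theorem. -/
theorem extremePoints_subset_of_closedConvexHull_eq {K Z : Set E} (hK : IsCompact K)
    (hZ : IsClosed Z) (h : closedConvexHull ℝ Z = K) : K.extremePoints ℝ ⊆ Z := by
  intro x hx
  have hKc : Convex ℝ K := h ▸ convex_closedConvexHull
  have hZK : Z ⊆ K := h ▸ subset_closedConvexHull
  have : CompactSpace K := isCompact_iff_compactSpace.1 hK
  by_contra hxZ
  -- Pairs of a measure concentrated on `Z` and its barycenter. The second projection is compact,
  -- convex and contains `Z`, so it contains `K`. Thus `x` is the barycenter of a measure on `Z`,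
  -- which by Bauer is `δ_x`; a Urysohn function then excludes `x ∉ Z`.
  let S : Set (WeakDual ℝ C(K, ℝ) × E) :=
    (RegProb K ×ˢ K) ∩ {p | (∀ f : C(K, ℝ), (∀ z : K, (z : E) ∈ Z → f z = 0) → p.1 f = 0) ∧
      ∀ ℓ : StrongDual ℝ E, ℓ p.2 = p.1 ⟨fun y => ℓ (y : E), by fun_prop⟩}
  have hS : IsCompact S := by
    refine (regProb_isCompact.prod hK).inter_right ?_
    have h1 : IsClosed {p : WeakDual ℝ C(K, ℝ) × E |
        ∀ f : C(K, ℝ), (∀ z : K, (z : E) ∈ Z → f z = 0) → p.1 f = 0} := by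
      simp only [Set.ofPred_forall]
      exact isClosed_iInter fun f => isClosed_iInter fun _ =>
        isClosed_eq ((WeakDual.eval_continuous _).comp continuous_fst) continuous_const
    have h2 : IsClosed {p : WeakDual ℝ C(K, ℝ) × E |
        ∀ ℓ : StrongDual ℝ E, ℓ p.2 = p.1 ⟨fun y => ℓ (y : E), by fun_prop⟩} := by
      simp only [Set.ofPred_forall]
      exact isClosed_iInter fun ℓ => isClosed_eq (ℓ.continuous.comp continuous_snd)
        ((WeakDual.eval_continuous _).comp continuous_fst)
    exact h1.inter h2
  have hSc : Convex ℝ S := by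
    refine (regProb_convex.prod hKc).inter ?_
    intro p hp p' hp' a b _ _ _
    refine ⟨fun f hf => ?_, fun ℓ => ?_⟩
    · change a • p.1 f + b • p'.1 f = 0
      rw [hp.1 f hf, hp'.1 f hf, smul_zero, smul_zero, add_zero]
    · change ℓ (a • p.2 + b • p'.2) = a • p.1 _ + b • p'.1 _
      rw [map_add, map_smul, map_smul, hp.2 ℓ, hp'.2 ℓ]
  have hsub : K ⊆ Prod.snd '' S := by
    refine h.symm.subset.trans (closedConvexHull_min (fun z hz => ?_)
      (hSc.linear_image (LinearMap.snd ℝ (WeakDual ℝ C(K, ℝ)) E))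
      (hS.image continuous_snd).isClosed)
    exact ⟨((pointMass (⟨z, hZK hz⟩ : K) : WeakDual ℝ C(K, ℝ)), z),
      ⟨⟨Subtype.coe_prop _, hZK hz⟩, fun f hf => hf _ hz, fun ℓ => rfl⟩, rfl⟩
  obtain ⟨⟨Λ, k⟩, ⟨⟨hΛ, -⟩, hΛZ, hb⟩, rfl : k = x⟩ := hsub hx.1
  have heq := eq_pointMass_of_barycenter_mem_extremePoints (x := (⟨k, hx.1⟩ : K)) hK hKc
    (q := Subtype.val) continuous_subtype_val Subtype.val_injective (fun y => y.2) hx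
    (Λ := ⟨Λ, hΛ⟩) fun ℓ => (hb ℓ).symm
  obtain ⟨f, hf0, hf1, -⟩ := exists_continuous_zero_one_of_isClosed
    (hZ.preimage (continuous_subtype_val (p := (· ∈ K)))) (isClosed_singleton (x := (⟨k, hx.1⟩ : K)))
    (Set.disjoint_singleton_right.2 hxZ)
  have h1 := hΛZ f fun z hz => hf0 hz
  have h2 : Λ f = f ⟨k, hx.1⟩ := by rw [← pointMass_apply, ← heq]
  rw [h1, hf1 rfl] at h2
  simp at h2

end Barycenter

end

noncomputable section

/-! ### Fixed points of affine flows of amenable groups -/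

section FixedPoint

theorem PreservesConvexComb.comp {E F E' : Type*} [AddCommGroup E] [Module ℝ E] [AddCommGroup F]
    [Module ℝ F] [AddCommGroup E'] [Module ℝ E'] {K : Set E} {L : Set F} {M : Set E'} {g : L → M}
    {f : K → L} (hg : PreservesConvexComb g) (hf : PreservesConvexComb f) :
    PreservesConvexComb fun x => g (f x) :=
  fun x y z a b ha hb hab h => hg _ _ _ a b ha hb hab (hf x y z a b ha hb hab h)

variable {G : Type u} [Group G] [TopologicalSpace G]

/-! ### Subflows, minimality and extreme points of affine flows -/

namespace AffineFlow

/-- The restriction of the action to an invariant subset. -/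
abbrev subAction (K : AffineFlow G) {S : Set K.E} (hS : S ⊆ K.carrier)
    (hinv : ∀ (g : G) (x : K.carrier), (x : K.E) ∈ S → ((g • x : K.carrier) : K.E) ∈ S) :
    MulAction G S where
  smul g x := ⟨(g • (⟨x, hS x.2⟩ : K.carrier) : K.carrier), hinv g ⟨x, hS x.2⟩ x.2⟩
  one_smul x := Subtype.ext (congrArg Subtype.val (one_smul G (⟨x, hS x.2⟩ : K.carrier)) :)
  mul_smul g h x := Subtype.ext (congrArg Subtype.val (mul_smul g h (⟨x, hS x.2⟩ : K.carrier)) :)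

theorem continuousSMul_subAction (K : AffineFlow G) {S : Set K.E} (hS : S ⊆ K.carrier)
    (hinv : ∀ (g : G) (x : K.carrier), (x : K.E) ∈ S → ((g • x : K.carrier) : K.E) ∈ S) :
    letI := K.subAction hS hinv
    ContinuousSMul G S := by
  let _ := K.subAction hS hinv
  refine ⟨Continuous.subtype_mk ?_ _⟩
  have : Continuous fun p : G × S => p.1 • (⟨p.2, hS p.2.2⟩ : K.carrier) := by fun_prop
  exact continuous_subtype_val.comp this

/-- Nonempty closed convex invariant subsets of an affine flow. -/
structure IsSubflow (K : AffineFlow G) (S : Set K.E) : Prop where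
  subset : S ⊆ K.carrier
  nonempty : S.Nonempty
  isClosed : IsClosed S
  convex : Convex ℝ S
  smul_mem : ∀ (g : G) (x : K.carrier), (x : K.E) ∈ S → ((g • x : K.carrier) : K.E) ∈ S

/-- A nonempty closed convex invariant subset as an affine flow. -/
def subflow (K : AffineFlow G) (S : Set K.E) (h : K.IsSubflow S) : AffineFlow G where
  E := K.E
  carrier := S
  nonempty := h.nonempty
  isCompact := K.isCompact.of_isClosed_subset h.isClosed h.subset
  convex := h.convex
  action := K.subAction h.subset h.smul_mem
  continuous_action := K.continuousSMul_subAction h.subset h.smul_mem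
  affine_action g x y z a b ha hb hab hz :=
    K.affine_action g ⟨x, h.subset x.2⟩ ⟨y, h.subset y.2⟩ ⟨z, h.subset z.2⟩ a b ha hb hab hz

/-- Zorn's lemma for reverse inclusion; compactness of the carrier keeps the intersection of a chain
nonempty. -/
theorem exists_minimal_subflow (K : AffineFlow G) :
    ∃ S, K.IsSubflow S ∧ ∀ T ⊆ S, K.IsSubflow T → T = S := by
  obtain ⟨m, hm⟩ := zorn_superset_nonempty {S | K.IsSubflow S} (fun c hc hchain hne => by
    have hne' : (⋂₀ c).Nonempty := by
      have : Nonempty c := hne.to_subtype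
      rw [Set.sInter_eq_iInter]
      refine IsCompact.nonempty_iInter_of_directed_nonempty_isCompact_isClosed _ ?_
        (fun S => (hc S.2).nonempty)
        (fun S => K.isCompact.of_isClosed_subset (hc S.2).isClosed (hc S.2).subset)
        fun S => (hc S.2).isClosed
      exact directedOn_iff_directed.1 (IsChain.directedOn hchain.symm)
    obtain ⟨S₀, hS₀⟩ := hne
    exact ⟨⋂₀ c, ⟨(Set.sInter_subset_of_mem hS₀).trans (hc hS₀).subset, hne',
      isClosed_sInter fun S hS => (hc hS).isClosed, convex_sInter fun S hS => (hc hS).convex,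
      fun g x hx S hS => (hc hS).smul_mem g x (hx S hS)⟩, fun S hS => Set.sInter_subset_of_mem hS⟩)
    K.carrier ⟨subset_rfl, K.nonempty, K.isCompact.isClosed, K.convex, fun g x _ => (g • x).2⟩
  exact ⟨m, hm.2.prop, fun T hT hT' => hm.2.eq_of_subset hT' hT⟩

theorem isSubflow_closedConvexHull_orbit (K : AffineFlow G) (k : K.carrier) :
    K.IsSubflow (closedConvexHull ℝ (Set.range fun g : G => ((g • k : K.carrier) : K.E))) where
  subset := closedConvexHull_min (Set.range_subset_iff.2 fun g => (g • k).2) K.convex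
    K.isCompact.isClosed
  nonempty := ⟨_, subset_closedConvexHull ⟨1, rfl⟩⟩
  isClosed := isClosed_closedConvexHull
  convex := convex_closedConvexHull
  smul_mem g x hx := by
    set S := closedConvexHull ℝ (Set.range fun g : G => ((g • k : K.carrier) : K.E))
    -- The points that `g` moves into the hull `S` form a closed convex set containing the orbit,
    -- hence containing `S`.
    let T : Set K.E := Subtype.val '' {y : K.carrier | ((g • y : K.carrier) : K.E) ∈ S}
    have hT : IsClosed T := by
      refine K.isCompact.isClosed.isClosedEmbedding_subtypeVal.isClosedMap _ ?_
      exact isClosed_closedConvexHull.preimage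
        (continuous_subtype_val.comp (continuous_const_smul g))
    have hTc : Convex ℝ T := by
      rintro _ ⟨y, hy, rfl⟩ _ ⟨z, hz, rfl⟩ a b ha hb hab
      refine ⟨⟨_, K.convex y.2 z.2 ha hb hab⟩, ?_, rfl⟩
      have := K.affine_action g y z ⟨_, K.convex y.2 z.2 ha hb hab⟩ a b ha hb hab rfl
      change ((g • (_ : K.carrier) : K.carrier) : K.E) ∈ S
      rw [this]
      exact convex_closedConvexHull hy hz ha hb hab
    have : S ⊆ T := by
      refine closedConvexHull_min ?_ hTc hT
      rintro _ ⟨h, rfl⟩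
      refine ⟨h • k, subset_closedConvexHull ⟨g * h, ?_⟩, rfl⟩
      change ((_ : K.carrier) : K.E) = _
      rw [mul_smul]
    obtain ⟨y, hy, hyx⟩ := this hx
    rwa [Subtype.ext hyx] at hy

theorem smul_mem_extremePoints (K : AffineFlow G) (g : G) (x : K.carrier)
    (hx : (x : K.E) ∈ K.carrier.extremePoints ℝ) :
    ((g • x : K.carrier) : K.E) ∈ K.carrier.extremePoints ℝ := by
  refine mem_extremePoints_iff_left.2 ⟨(g • x).2, ?_⟩
  rintro y hy z hz ⟨a, b, ha, hb, hab, h⟩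
  have h1 := K.affine_action g⁻¹ ⟨y, hy⟩ ⟨z, hz⟩ (g • x) a b ha.le hb.le hab h.symm
  simp only [inv_smul_smul] at h1
  have h2 := (mem_extremePoints_iff_left.1 hx).2 _ (g⁻¹ • (⟨y, hy⟩ : K.carrier)).2 _
    (g⁻¹ • (⟨z, hz⟩ : K.carrier)).2 ⟨a, b, ha, hb, hab, h1.symm⟩
  rw [← Subtype.ext h2, smul_inv_smul]

theorem smul_mem_closure_extremePoints (K : AffineFlow G) (g : G) (x : K.carrier)
    (hx : (x : K.E) ∈ closure (K.carrier.extremePoints ℝ)) :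
    ((g • x : K.carrier) : K.E) ∈ closure (K.carrier.extremePoints ℝ) := by
  have hi : Subtype.val '' {y : K.carrier | (y : K.E) ∈ K.carrier.extremePoints ℝ} =
      K.carrier.extremePoints ℝ := by
    ext y
    exact ⟨by rintro ⟨z, hz, rfl⟩; exact hz, fun hy => ⟨⟨y, hy.1⟩, hy, rfl⟩⟩
  rw [← hi, ← closure_subtype] at hx ⊢
  exact map_mem_closure (continuous_const_smul g) hx fun y hy => K.smul_mem_extremePoints g y hy

/-- In a minimal affine flow, the closure of the extreme points is strongly proximal. -/
theorem exists_fixed_of_minimal (hG : IsAmenableTopGroup G) (K : AffineFlow G)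
    (hmin : ∀ S, K.IsSubflow S → S = K.carrier) : ∃ x : K.carrier, ∀ g : G, g • x = x := by
  set X : Set K.E := closure (K.carrier.extremePoints ℝ) with hX
  have hXK : X ⊆ K.carrier := closure_minimal extremePoints_subset K.isCompact.isClosed
  let _ : MulAction G X := K.subAction hXK K.smul_mem_closure_extremePoints
  have _ : ContinuousSMul G X := K.continuousSMul_subAction hXK K.smul_mem_closure_extremePoints
  have _ : CompactSpace X :=
    isCompact_iff_compactSpace.1 (K.isCompact.of_isClosed_subset isClosed_closure hXK)
  have _ : Nonempty X := ((K.isCompact.extremePoints_nonempty K.nonempty).mono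
    subset_closure).to_subtype
  obtain ⟨b, hbc, hba, hb, hbp⟩ := exists_barycenter_map (j := (id : X → X)) denseRange_id
    K.isCompact K.convex (fun x => ⟨x, hXK x.2⟩) (fun ℓ => ⟨fun y => ℓ (y : K.E), by fun_prop⟩)
    fun _ _ => rfl
  have hbe : ∀ (g : G) (μ : RegProb X), b (g • μ) = g • b μ := by
    intro g μ
    refine congrFun (regProb_map_ext (f := fun μ => b (g • μ)) (g := fun μ => g • b μ)
      (j := (id : X → X)) denseRange_id (hbc.comp (continuous_const_smul g))
      (hbc.const_smul g) (hba.comp ((probFlow G X).affine_action g))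
      ((K.affine_action g).comp hba) fun x => ?_) μ
    have h1 := hbp x
    have h2 := hbp (g • x)
    simp only [id] at h1 h2 ⊢
    rw [smul_pointMass, h1, h2]
    rfl
  suffices hprox : IsStronglyProximalFlow G X by
    obtain ⟨x, hx⟩ := hG X hprox
    exact ⟨⟨x, hXK x.2⟩, fun g => Subtype.ext (congrArg Subtype.val (hx g) :)⟩
  intro μ ν
  obtain ⟨x, hx⟩ := K.isCompact.extremePoints_nonempty K.nonempty
  let x' : X := ⟨x, subset_closure hx⟩
  have hmem : (1 / 2 : ℝ) • (b μ : K.E) + (1 / 2 : ℝ) • (b ν : K.E) ∈ K.carrier :=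
    K.convex (b μ).2 (b ν).2 (by norm_num) (by norm_num) (by norm_num)
  -- `k` is the midpoint of the two barycenters. By minimality its orbit has closed convex hull `K`,
  -- so Milman's theorem puts the extreme point `x` in the orbit closure.
  set k : K.carrier := ⟨_, hmem⟩ with hk
  have hxk : x ∈ closure (Set.range fun g : G => ((g • k : K.carrier) : K.E)) := by
    refine extremePoints_subset_of_closedConvexHull_eq K.isCompact isClosed_closure ?_ hx
    rw [closedConvexHull_closure_eq_closedConvexHull]
    exact hmin _ (K.isSubflow_closedConvexHull_orbit k)
  have hne : (comap (fun g : G => ((g • k : K.carrier) : K.E)) (𝓝 x)).NeBot :=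
    comap_neBot_iff.2 fun t ht => by
      obtain ⟨_, hy, g, rfl⟩ := mem_closure_iff_nhds.1 hxk t ht
      exact ⟨g, hy⟩
  -- Along an ultrafilter `g • μ` and `g • ν` converge as well, by compactness of `P(X)`.
  let U := Ultrafilter.of (comap (fun g : G => ((g • k : K.carrier) : K.E)) (𝓝 x))
  have hUk : Tendsto (fun g : G => ((g • k : K.carrier) : K.E)) U (𝓝 x) :=
    tendsto_comap.mono_left (Ultrafilter.of_le _)
  have _ : CompactSpace (RegProb X) := isCompact_iff_compactSpace.1 regProb_isCompact
  have hlim : ∀ μ : RegProb X, ∃ μ', Tendsto (fun g : G => g • μ) U (𝓝 μ') := fun μ =>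
    ⟨_, (U.map fun g : G => g • μ).le_nhds_lim⟩
  obtain ⟨μ', hμ'⟩ := hlim μ
  obtain ⟨ν', hν'⟩ := hlim ν
  have h1 : ∀ {μ μ' : RegProb X}, Tendsto (fun g : G => g • μ) U (𝓝 μ') →
      Tendsto (fun g : G => ((g • b μ : K.carrier) : K.E)) U (𝓝 (b μ')) := by
    intro μ μ' h
    have := ((continuous_subtype_val.comp hbc).tendsto μ').comp h
    simpa only [comp_def, hbe] using this
  have h2 : (1 / 2 : ℝ) • (b μ' : K.E) + (1 / 2 : ℝ) • (b ν' : K.E) = x := by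
    refine tendsto_nhds_unique ?_ hUk
    have : (fun g : G => ((g • k : K.carrier) : K.E)) = fun g : G =>
        (1 / 2 : ℝ) • ((g • b μ : K.carrier) : K.E) +
          (1 / 2 : ℝ) • ((g • b ν : K.carrier) : K.E) := by
      funext g
      exact K.affine_action g (b μ) (b ν) k _ _ (by norm_num) (by norm_num) (by norm_num) rfl
    rw [this]
    exact ((h1 hμ').const_smul _).add ((h1 hν').const_smul _)
  -- The barycenters of the two limits average to the extreme point `x`, so both equal `x`, and by
  -- Bauer both limits are `δ_x`.
  have hbauer : ∀ μ' : RegProb X, (b μ' : K.E) = x → μ' = pointMass x' := fun μ' h =>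
    eq_pointMass_of_barycenter_mem_extremePoints K.isCompact K.convex (q := Subtype.val)
      continuous_subtype_val Subtype.val_injective (fun y => hXK y.2) (x := x') hx fun ℓ => by
        rw [← hb, h]
  have hbμ := (mem_extremePoints.1 hx).2 _ (b μ').2 _ (b ν').2
    ⟨1 / 2, 1 / 2, by norm_num, by norm_num, by norm_num, h2⟩
  exact ⟨U, inferInstance, pointMass x', hbauer μ' hbμ.1 ▸ hμ', hbauer ν' hbμ.2 ▸ hν'⟩

/-- Every affine flow of an amenable group has a fixed point. -/
theorem exists_fixed (hG : IsAmenableTopGroup G) (K : AffineFlow G) :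
    ∃ x : K.carrier, ∀ g : G, g • x = x := by
  obtain ⟨S, hS, hmin⟩ := K.exists_minimal_subflow
  obtain ⟨x, hx⟩ := exists_fixed_of_minimal hG (K.subflow S hS) fun T hT =>
    hmin T hT.subset ⟨hT.subset.trans hS.subset, hT.nonempty, hT.isClosed, hT.convex,
      fun g y hy => hT.smul_mem g ⟨y.1, hT.subset hy⟩ hy⟩
  exact ⟨⟨x.1, hS.subset x.2⟩, fun g => Subtype.ext (congrArg Subtype.val (hx g) :)⟩

end AffineFlow

end FixedPoint

end

noncomputable section

/-! ### Invariant means on right uniformly continuous functions -/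

/-- A form of the M. Riesz extension theorem: a functional that is nonnegative where `r` takes
values in the cone `s` factors through a functional that is nonnegative on `s`. -/
theorem exists_nonneg_extension {V E : Type*} [AddCommGroup V] [Module ℝ V] [AddCommGroup E]
    [Module ℝ E] (s : PointedCone ℝ E) (r : V →ₗ[ℝ] E) (m : V →ₗ[ℝ] ℝ)
    (hm : ∀ v, r v ∈ s → 0 ≤ m v) (hs : ∀ y, ∃ v, r v + y ∈ s) :
    ∃ M : E →ₗ[ℝ] ℝ, (∀ v, M (r v) = m v) ∧ ∀ y ∈ s, 0 ≤ M y := by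
  -- If `r v = 0` then both `v` and `-v` are mapped into the cone, so `m v = 0`. This lets `m`
  -- descend to the range of `r`, although `r` need not be injective.
  have hker : LinearMap.ker r ≤ LinearMap.ker m := by
    intro v hv
    rw [LinearMap.mem_ker] at hv ⊢
    have h1 := hm v (by rw [hv]; exact zero_mem s)
    have h2 := hm (-v) (by rw [map_neg, hv, neg_zero]; exact zero_mem s)
    rw [map_neg] at h2
    linarith
  let f : E →ₗ.[ℝ] ℝ := ⟨LinearMap.range r,
    (LinearMap.ker r).liftQ m hker ∘ₗ (r.quotKerEquivRange.symm : _ →ₗ[ℝ] _)⟩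
  have hf : ∀ v (h : r v ∈ LinearMap.range r), f ⟨r v, h⟩ = m v := by
    intro v h
    change (LinearMap.ker r).liftQ m hker (r.quotKerEquivRange.symm ⟨r v, h⟩) = m v
    rw [LinearMap.quotKerEquivRange_symm_apply_image]
    rfl
  obtain ⟨M, h1, h2⟩ := riesz_extension s f
    (by
      rintro ⟨_, v, rfl⟩ h
      exact (hm v h).trans_eq (hf v ⟨v, rfl⟩).symm)
    (fun y => by
      obtain ⟨v, hv⟩ := hs y
      exact ⟨⟨r v, v, rfl⟩, hv⟩)
  exact ⟨M, fun v => (h1 ⟨r v, v, rfl⟩).trans (hf v _), h2⟩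

/-! ### Bounded right uniformly continuous real functions on a group -/

section RUCFunctions

/-- The bounded right uniformly continuous real functions on a topological group. -/
def rucFun (G : Type*) [Group G] [TopologicalSpace G] : Submodule ℝ (G → ℝ) where
  carrier := {f | (∃ C, ∀ g, |f g| ≤ C) ∧
    ∀ ε > 0, ∃ U ∈ 𝓝 (1 : G), ∀ u ∈ U, ∀ g, |f (u * g) - f g| < ε}
  add_mem' := by
    rintro f f' ⟨⟨C, hC⟩, hf⟩ ⟨⟨C', hC'⟩, hf'⟩
    refine ⟨⟨C + C', fun g => (abs_add_le _ _).trans (add_le_add (hC g) (hC' g))⟩, fun ε hε => ?_⟩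
    obtain ⟨U, hU, h⟩ := hf (ε / 2) (half_pos hε)
    obtain ⟨U', hU', h'⟩ := hf' (ε / 2) (half_pos hε)
    refine ⟨U ∩ U', inter_mem hU hU', fun u hu g => ?_⟩
    have h1 := abs_lt.1 (h u hu.1 g)
    have h2 := abs_lt.1 (h' u hu.2 g)
    simp only [Pi.add_apply]
    rw [abs_lt]
    constructor <;> linarith
  zero_mem' := ⟨⟨0, by simp⟩, fun ε hε => ⟨Set.univ, univ_mem, by simpa using hε⟩⟩
  smul_mem' := by
    rintro c f ⟨⟨C, hC⟩, hf⟩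
    refine ⟨⟨|c| * C, fun g => ?_⟩, fun ε hε => ?_⟩
    · simp only [Pi.smul_apply, smul_eq_mul, abs_mul]
      exact mul_le_mul_of_nonneg_left (hC g) (abs_nonneg c)
    · obtain ⟨U, hU, h⟩ := hf (ε / (|c| + 1)) (by positivity)
      refine ⟨U, hU, fun u hu g => ?_⟩
      have h1 := h u hu g
      rw [lt_div_iff₀ (by positivity)] at h1
      simp only [Pi.smul_apply, smul_eq_mul, ← mul_sub, abs_mul]
      nlinarith [abs_nonneg (f (u * g) - f g)]

variable {G : Type u} [Group G] [TopologicalSpace G]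

theorem const_mem_rucFun (c : ℝ) : (fun _ => c) ∈ rucFun G :=
  ⟨⟨|c|, fun _ => le_rfl⟩, fun ε hε => ⟨Set.univ, univ_mem, by simpa using hε⟩⟩

theorem translate_mem_rucFun [IsTopologicalGroup G] {f : G → ℝ} (hf : f ∈ rucFun G) (h : G) :
    (fun g => f (h * g)) ∈ rucFun G := by
  obtain ⟨⟨C, hC⟩, hf⟩ := hf
  refine ⟨⟨C, fun g => hC _⟩, fun ε hε => ?_⟩
  obtain ⟨U, hU, hfU⟩ := hf ε hε
  have hc : Tendsto (fun u : G => h * u * h⁻¹) (𝓝 1) (𝓝 1) := by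
    have : Continuous fun u : G => h * u * h⁻¹ := by fun_prop
    simpa using this.tendsto 1
  refine ⟨_, hc hU, fun u hu g => ?_⟩
  have := hfU _ hu (h * g)
  simpa [mul_assoc] using this

/-- Restriction of right uniformly continuous functions to a subgroup. -/
def rucFunRestrict (H : Subgroup G) : rucFun G →ₗ[ℝ] rucFun H where
  toFun f := ⟨fun h => f.1 h, by
    obtain ⟨⟨C, hC⟩, hf⟩ := f.2
    refine ⟨⟨C, fun g => hC _⟩, fun ε hε => ?_⟩
    obtain ⟨U, hU, hfU⟩ := hf ε hε
    exact ⟨_, (continuous_subtype_val.tendsto (1 : H)) hU, fun u hu h => hfU u hu h⟩⟩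
  map_add' _ _ := rfl
  map_smul' _ _ := rfl

/-- Orbit functions of a flow are right uniformly continuous. -/
def orbitFun (G : Type u) [Group G] [TopologicalSpace G] {X : Type u} [TopologicalSpace X]
    [CompactSpace X] [T2Space X] [MulAction G X] [ContinuousSMul G X] (x : X) :
    C(X, ℝ) →ₗ[ℝ] rucFun G where
  toFun F := ⟨fun g => F (g • x), ⟨‖F‖, fun g => F.norm_coe_le_norm _⟩, fun ε hε => by
    have h := (continuous_translateC (G := G) F).tendsto 1
    refine ⟨_, h (Metric.ball_mem_nhds _ hε), fun u hu g => ?_⟩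
    have h1 : dist (translateC u F) (translateC (1 : G) F) < ε := hu
    have h2 := (ContinuousMap.dist_apply_le_dist (g • x)).trans_lt h1
    simpa [translateC_apply, Real.dist_eq, mul_smul] using h2⟩
  map_add' _ _ := rfl
  map_smul' _ _ := rfl

/-- A group with a left invariant mean on its right uniformly continuous functions is amenable. -/
theorem isAmenableTopGroup_of_mean (M : rucFun G →ₗ[ℝ] ℝ)
    (hpos : ∀ f : rucFun G, (∀ g, 0 ≤ f.1 g) → 0 ≤ M f)
    (hone : M ⟨fun _ => 1, const_mem_rucFun 1⟩ = 1)
    (hinv : ∀ (h : G) (f f' : rucFun G), (∀ g, f'.1 g = f.1 (h * g)) → M f' = M f) :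
    IsAmenableTopGroup G := by
  intro X _ _ _ _ _ _ hX
  obtain ⟨x⟩ := ‹Nonempty X›
  have hle : ∀ F : C(X, ℝ), M (orbitFun G x F) ≤ ‖F‖ := by
    intro F
    have := hpos (‖F‖ • ⟨fun _ => 1, const_mem_rucFun 1⟩ - orbitFun G x F) fun g => by
      change 0 ≤ ‖F‖ * 1 - F (g • x)
      linarith [(abs_le.1 (F.norm_coe_le_norm (g • x))).2]
    rw [map_sub, map_smul, hone, smul_eq_mul, mul_one] at this
    linarith
  let L : C(X, ℝ) →L[ℝ] ℝ := LinearMap.mkContinuous (M ∘ₗ orbitFun G x) 1 fun F => by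
    rw [one_mul, Real.norm_eq_abs, abs_le]
    have := hle (-F)
    rw [map_neg, map_neg, norm_neg] at this
    exact ⟨by simpa using by linarith, hle F⟩
  have hL : ∀ F, L F = M (orbitFun G x F) := fun _ => rfl
  -- The mean transported along the orbit map of `x` is an invariant measure.
  let Λ : RegProb X := ⟨L, (mem_regProb_iff _).2
    ⟨hone, fun F hF => hpos _ fun g => hF (g • x)⟩⟩
  have hfix : ∀ g : G, g • Λ = Λ := by
    intro g
    refine Subtype.ext (DFunLike.ext _ _ fun F => ?_)
    rw [regProb_smul_apply]
    refine hinv g _ _ fun g' => ?_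
    change F (g • g' • x) = F ((g * g') • x)
    rw [mul_smul]
  -- Proximality of `Λ` and `δ_x`: since `Λ` does not move, it is the limit of the point masses
  -- `δ_{g x}`. Point masses form a closed set, so `Λ = δ_y`, and invariance of `Λ` makes `y` fixed.
  obtain ⟨𝓕, _, z, h1, h2⟩ := hX Λ (pointMass x)
  simp only [hfix, smul_pointMass] at h1 h2
  have hz : z = Λ := tendsto_nhds_unique h1 tendsto_const_nhds
  have hcl : IsClosed (Set.range (pointMass : X → RegProb X)) :=
    (isCompact_range continuous_pointMass).isClosed
  obtain ⟨y, hy⟩ := hcl.mem_of_tendsto h2 (Eventually.of_forall fun g => ⟨g • x, rfl⟩)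
  refine ⟨y, fun g => pointMass_injective ?_⟩
  rw [← smul_pointMass, hy, hz, hfix]

/-- A metric inducing the right uniform structure of a first countable group. -/
theorem exists_rightUniform_dist (G : Type*) [Group G] [TopologicalSpace G] [IsTopologicalGroup G]
    [FirstCountableTopology G] : ∃ d : G → G → ℝ, (∀ a b, 0 ≤ d a b) ∧ (∀ a, d a a = 0) ∧
      (∀ a b c, d a c ≤ d a b + d b c) ∧
      (∀ δ > 0, ∃ U ∈ 𝓝 (1 : G), ∀ u ∈ U, ∀ g, d (u * g) g < δ ∧ d g (u * g) < δ) ∧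
      ∀ U ∈ 𝓝 (1 : G), ∃ δ > 0, ∀ a b, d a b < δ → b * a⁻¹ ∈ U := by
  let _ : UniformSpace G := IsTopologicalGroup.rightUniformSpace G
  have hu : uniformity G = comap (fun p : G × G => p.2 * p.1⁻¹) (𝓝 1) := rfl
  have _ : (uniformity G).IsCountablyGenerated := by rw [hu]; infer_instance
  let _ : PseudoMetricSpace G := UniformSpace.pseudoMetricSpace G
  refine ⟨dist, fun _ _ => dist_nonneg, dist_self, dist_triangle, fun δ hδ => ?_, fun U hU => ?_⟩
  · have h1 := Metric.dist_mem_uniformity (α := G) hδ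
    rw [hu] at h1
    obtain ⟨U, hU, h⟩ := h1
    refine ⟨U, hU, fun u hu' g => ?_⟩
    have : dist g (u * g) < δ := @h (g, u * g) (by simpa using hu')
    exact ⟨by rwa [dist_comm], this⟩
  · have h1 : (fun p : G × G => p.2 * p.1⁻¹) ⁻¹' U ∈ uniformity G := by
      rw [hu]; exact preimage_mem_comap hU
    obtain ⟨δ, hδ, h⟩ := Metric.mem_uniformity_dist.1 h1
    exact ⟨δ, hδ, fun a b hab => h hab⟩

/-! ### Passing from means on `G` to means on a subgroup -/

variable [IsTopologicalGroup G] [FirstCountableTopology G]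

/-- Bump functions on `G/H` around the base point. -/
theorem exists_rucFun_bump (H : Subgroup G) {U : Set G} (hU : U ∈ 𝓝 (1 : G)) :
    ∃ k ∈ rucFun G, (∀ g, ∀ h ∈ H, k (g * h) = k g) ∧ (∀ g, k g ≤ 1) ∧ (∀ g, 0 ≤ k g) ∧
      k 1 = 1 ∧ ∀ g, 0 < k g → ∃ h ∈ H, g * h ∈ U := by
  obtain ⟨d, hd0, hdd, hdt, hdU, hdU'⟩ := exists_rightUniform_dist G
  obtain ⟨δ, hδ, hδU⟩ := hdU' U hU
  -- `D g` is the distance from `1` to the coset `gH`, so it is constant on cosets. It is right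
  -- uniformly continuous because a left translation by `u` near `1` displaces all points by a
  -- uniformly small distance. The bump function is `max 0 (1 - D/δ)`.
  let D : G → ℝ := fun g => ⨅ h : H, d 1 (g * h)
  have hbdd : ∀ g, BddBelow (Set.range fun h : H => d 1 (g * h)) := fun g =>
    ⟨0, by rintro _ ⟨h, rfl⟩; exact hd0 _ _⟩
  have hD0 : ∀ g, 0 ≤ D g := fun g => le_ciInf fun h => hd0 _ _
  have hDle : ∀ g (h : H), D g ≤ d 1 (g * h) := fun g h => ciInf_le (hbdd g) h
  have hDinv : ∀ g, ∀ h ∈ H, D (g * h) = D g := by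
    intro g h hh
    refine le_antisymm (le_ciInf fun h' => ?_) (le_ciInf fun h' => ?_)
    · have := hDle (g * h) (⟨h, hh⟩⁻¹ * h')
      simpa [mul_assoc] using this
    · have := hDle g (⟨h, hh⟩ * h')
      simpa [mul_assoc] using this
  have hD1 : D 1 = 0 := le_antisymm (by simpa [hdd] using hDle 1 1) (hD0 1)
  have hDlip : ∀ ε > 0, ∃ U ∈ 𝓝 (1 : G), ∀ u ∈ U, ∀ g, |D (u * g) - D g| ≤ ε := by
    intro ε hε
    obtain ⟨U, hU, h⟩ := hdU ε hε
    refine ⟨U, hU, fun u hu g => abs_le.2 ⟨?_, ?_⟩⟩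
    · suffices D g - ε ≤ D (u * g) by linarith
      refine le_ciInf fun h' => ?_
      have h1 := hDle g h'
      have h2 := hdt 1 (u * (g * h')) (g * h')
      have h3 := (h u hu (g * h')).1
      rw [← mul_assoc] at h2 h3
      linarith
    · suffices D (u * g) - ε ≤ D g by linarith
      refine le_ciInf fun h' => ?_
      have h1 := hDle (u * g) h'
      have h2 := hdt 1 (g * h') (u * (g * h'))
      have h3 := (h u hu (g * h')).2
      rw [mul_assoc] at h1
      linarith
  refine ⟨fun g => max 0 (1 - δ⁻¹ * D g), ⟨⟨1, fun g => ?_⟩, fun ε hε => ?_⟩, ?_, ?_, ?_, ?_, ?_⟩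
  · have : 0 ≤ δ⁻¹ * D g := mul_nonneg (inv_nonneg.2 hδ.le) (hD0 g)
    rw [abs_of_nonneg (le_max_left _ _)]
    exact max_le zero_le_one (by linarith)
  · obtain ⟨U, hU, h⟩ := hDlip (δ * (ε / 2)) (by positivity)
    refine ⟨U, hU, fun u hu g => ?_⟩
    refine (abs_max_sub_max_le_max _ _ _ _).trans_lt ?_
    have h1 := h u hu g
    have h2 : (1 - δ⁻¹ * D (u * g)) - (1 - δ⁻¹ * D g) = -(δ⁻¹ * (D (u * g) - D g)) := by ring
    rw [sub_self, abs_zero, h2, abs_neg, abs_mul, abs_of_pos (inv_pos.2 hδ)]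
    refine max_lt hε ?_
    calc δ⁻¹ * |D (u * g) - D g| ≤ δ⁻¹ * (δ * (ε / 2)) :=
          mul_le_mul_of_nonneg_left h1 (inv_nonneg.2 hδ.le)
      _ = ε / 2 := inv_mul_cancel_left₀ hδ.ne' _
      _ < ε := half_lt_self hε
  · intro g h hh
    simp only [hDinv g h hh]
  · intro g
    have : 0 ≤ δ⁻¹ * D g := mul_nonneg (inv_nonneg.2 hδ.le) (hD0 g)
    exact max_le zero_le_one (by linarith)
  · exact fun g => le_max_left _ _
  · simp [hD1]
  · intro g hg
    have h1 : 0 < 1 - δ⁻¹ * D g := by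
      rcases lt_max_iff.1 hg with h | h
      · exact absurd h (lt_irrefl _)
      · exact h
    have h2 : D g < δ := by
      have h3 : δ⁻¹ * D g < 1 := by linarith
      rwa [inv_mul_lt_iff₀ hδ, mul_one] at h3
    obtain ⟨h, hh⟩ := exists_lt_of_ciInf_lt h2
    exact ⟨h, h.2, by simpa using hδU _ _ hh⟩

/-- Right uniformly continuous functions on a subgroup are uniform limits of restrictions. -/
theorem exists_rucFunRestrict_approx (H : Subgroup G) (f : rucFun H) {ε : ℝ} (hε : 0 < ε) :
    ∃ F : rucFun G, ∀ h : H, |(rucFunRestrict H F).1 h - f.1 h| ≤ ε := by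
  obtain ⟨d, hd0, hdd, hdt, hdU, hdU'⟩ := exists_rightUniform_dist G
  obtain ⟨⟨C, hC⟩, hf⟩ := f.2
  obtain ⟨U, hU, hfU⟩ := hf ε hε
  obtain ⟨V, hV, hVU⟩ := mem_nhds_induced Subtype.val (1 : H) U |>.1 hU
  obtain ⟨δ, hδ, hδV⟩ := hdU' V hV
  have hC0 : 0 ≤ C := (abs_nonneg _).trans (hC 1)
  -- Slope for a McShane-type infimal convolution. It makes points at distance at least `δ`
  -- irrelevant on `H`: they contribute at least `-C + nδ = C`. Points closer than `δ` contribute at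
  -- least `f h - ε` by uniform continuity of `f`.
  set n : ℝ := 2 * C / δ
  have hn : 0 ≤ n := by positivity
  have hnδ : n * δ = 2 * C := div_mul_cancel₀ _ hδ.ne'
  let D : G → ℝ := fun g => ⨅ k : H, (f.1 k + n * d g k)
  have hlow : ∀ g (k : H), -C ≤ f.1 k + n * d g k := fun g k => by
    have := (abs_le.1 (hC k)).1
    have := mul_nonneg hn (hd0 g k)
    linarith
  have hDle : ∀ g (k : H), D g ≤ f.1 k + n * d g k := fun g k =>
    ciInf_le ⟨-C, by rintro _ ⟨h, rfl⟩; exact hlow _ _⟩ k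
  have hDlow : ∀ g, -C ≤ D g := fun g => le_ciInf (hlow g)
  have hDlip : ∀ g g', D g ≤ D g' + n * d g g' := by
    intro g g'
    rw [← sub_le_iff_le_add]
    refine le_ciInf fun k => ?_
    have h1 := hDle g k
    have h2 := mul_le_mul_of_nonneg_left (hdt g g' k) hn
    linarith
  -- `D` may be unbounded above, hence the truncation at `C`. It has no effect on `H`, where `D ≤ f
  -- ≤ C`.
  refine ⟨⟨fun g => min C (D g), ⟨C, fun g => abs_le.2 ⟨le_min (by linarith) (hDlow g),
    min_le_left _ _⟩⟩, fun η hη => ?_⟩, fun h => ?_⟩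
  · obtain ⟨W, hW, h⟩ := hdU (η / (n + 1)) (by positivity)
    refine ⟨W, hW, fun u hu g => ?_⟩
    refine (abs_min_sub_min_le_max _ _ _ _).trans_lt ?_
    rw [sub_self, abs_zero]
    refine max_lt hη (abs_lt.2 ?_)
    obtain ⟨h1, h2⟩ := h u hu g
    rw [lt_div_iff₀ (by positivity)] at h1 h2
    have h3 := hDlip (u * g) g
    have h4 := hDlip g (u * g)
    have h5 := hd0 (u * g) g
    have h6 := hd0 g (u * g)
    constructor <;> linarith
  · change |min C (D h) - f.1 h| ≤ ε
    have h1 : D h ≤ f.1 h := by simpa [hdd] using hDle h h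
    have h2 := (abs_le.1 (hC h)).2
    rw [min_eq_right (h1.trans h2), abs_le]
    refine ⟨?_, by linarith⟩
    suffices f.1 h - ε ≤ D h by linarith
    refine le_ciInf fun k => ?_
    by_cases hk : d h k < δ
    · have h3 := hfU (k * h⁻¹) (hVU (hδV _ _ hk)) h
      rw [inv_mul_cancel_right] at h3
      have h4 := mul_nonneg hn (hd0 h k)
      linarith [(abs_lt.1 h3).1]
    · have h3 := mul_le_mul_of_nonneg_left (not_lt.1 hk) hn
      have h4 := (abs_le.1 (hC k)).1
      linarith

/-- A subgroup `H` is amenable if `G` has an `H`-invariant mean that lives over the base point of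
`G/H`. -/
theorem isAmenableTopGroup_of_mean_over_point (H : Subgroup G) (m : rucFun G →ₗ[ℝ] ℝ)
    (hpos : ∀ f : rucFun G, (∀ g, 0 ≤ f.1 g) → 0 ≤ m f)
    (hinv : ∀ h ∈ H, ∀ f f' : rucFun G, (∀ g, f'.1 g = f.1 (h * g)) → m f' = m f)
    (hpt : ∀ k : rucFun G, (∀ g, ∀ h ∈ H, k.1 (g * h) = k.1 g) → m k = k.1 1) :
    IsAmenableTopGroup H := by
  let e : rucFun G := ⟨fun _ => 1, const_mem_rucFun 1⟩
  have he : m e = 1 := hpt e fun _ _ _ => rfl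
  -- The mean `m` only sees a neighbourhood of `H`. For a bump function `k` around `H`, the function
  -- `f + ε + C (1 - k)` is nonnegative: where `k = 0` because `f ≥ -C`, and where `k > 0` because
  -- `f ≥ -ε` there. Since `m k = k 1 = 1`, this gives `m f + ε ≥ 0`.
  have hposH : ∀ f : rucFun G, (∀ h ∈ H, 0 ≤ f.1 h) → 0 ≤ m f := by
    intro f hf
    refine le_of_forall_pos_le_add fun ε hε => ?_
    obtain ⟨⟨C, hC⟩, hfu⟩ := f.2
    obtain ⟨U, hU, hfU⟩ := hfu ε hε
    obtain ⟨k, hk, hkinv, hk1, hk0, hk11, hkU⟩ := exists_rucFun_bump H hU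
    have hC0 : 0 ≤ C := (abs_nonneg _).trans (hC 1)
    have h1 := hpos (f + ε • e + C • (e - ⟨k, hk⟩)) fun g => by
      change 0 ≤ f.1 g + ε * 1 + C * (1 - k g)
      rcases (hk0 g).eq_or_lt with h0 | h0
      · rw [← h0]
        linarith [(abs_le.1 (hC g)).1]
      · obtain ⟨h, hh, hgU⟩ := hkU g h0
        have h2 := hfU _ hgU h⁻¹
        rw [mul_inv_cancel_right] at h2
        have h3 := hf h⁻¹ (H.inv_mem hh)
        have h4 := mul_nonneg hC0 (sub_nonneg.2 (hk1 g))
        linarith [(abs_lt.1 h2).1]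
    have h2 : m ⟨k, hk⟩ = 1 := (hpt ⟨k, hk⟩ hkinv).trans hk11
    rw [map_add, map_add, map_smul, map_smul, map_sub, he, h2] at h1
    simpa using h1
  let s : PointedCone ℝ (rucFun H) :=
    { carrier := {f | ∀ h, 0 ≤ f.1 h}
      add_mem' := fun hf hf' h => add_nonneg (hf h) (hf' h)
      zero_mem' := fun h => le_rfl
      smul_mem' := fun c f hf h => mul_nonneg c.2 (hf h) }
  -- By `hposH`, `m` factors through restriction to `H`. Restrictions need not exhaust the functions
  -- on `H`, so the factor is extended positively.
  obtain ⟨M, hM, hMpos⟩ := exists_nonneg_extension s (rucFunRestrict H) m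
    (fun f hf => hposH f fun h hh => hf ⟨h, hh⟩)
    (fun f => by
      obtain ⟨⟨C, hC⟩, -⟩ := f.2
      refine ⟨C • e, fun h => ?_⟩
      change 0 ≤ C * 1 + f.1 h
      linarith [(abs_le.1 (hC h)).1])
  let e' : rucFun H := ⟨fun _ => 1, const_mem_rucFun 1⟩
  have he' : M e' = 1 := (hM e).trans he
  have hMle : ∀ (f f' : rucFun H) (ε : ℝ), (∀ h, |f.1 h - f'.1 h| ≤ ε) → M f ≤ M f' + ε := by
    intro f f' ε h
    have := hMpos (f' + ε • e' - f) fun x => by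
      change 0 ≤ f'.1 x + ε * 1 - f.1 x
      linarith [(abs_le.1 (h x)).2]
    rw [map_sub, map_add, map_smul, he', smul_eq_mul, mul_one] at this
    linarith
  -- Invariance of `M` is known only on restrictions, so `f` and its translate are replaced by the
  -- restrictions of some `F` and of the translate of `F`. Each replacement costs `ε`.
  have hMle' : ∀ (h : H) (f f' : rucFun H), (∀ g, f'.1 g = f.1 (h * g)) → ∀ ε > 0,
      M f' ≤ M f + 2 * ε ∧ M f ≤ M f' + 2 * ε := by
    intro h f f' hff' ε hε
    obtain ⟨F, hF⟩ := exists_rucFunRestrict_approx H f hε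
    let F' : rucFun G := ⟨fun g => F.1 (h * g), translate_mem_rucFun F.2 h⟩
    have hF' : ∀ g, |(rucFunRestrict H F').1 g - f'.1 g| ≤ ε := fun g => by
      rw [hff' g]
      exact hF (h * g)
    have h1 : M (rucFunRestrict H F') = M (rucFunRestrict H F) := by
      rw [hM, hM]
      exact hinv h h.2 _ _ fun _ => rfl
    have h2 := hMle _ _ _ hF
    have h3 := hMle _ _ _ hF'
    have h4 := hMle _ _ _ fun g => (abs_sub_comm _ _).trans_le (hF g)
    have h5 := hMle _ _ _ fun g => (abs_sub_comm _ _).trans_le (hF' g)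
    constructor <;> linarith
  refine isAmenableTopGroup_of_mean M hMpos he' fun h f f' hff' => ?_
  refine le_antisymm (le_of_forall_pos_le_add fun ε hε => ?_)
    (le_of_forall_pos_le_add fun ε hε => ?_)
  · linarith [(hMle' h f f' hff' (ε / 2) (half_pos hε)).1]
  · linarith [(hMle' h f f' hff' (ε / 2) (half_pos hε)).2]

end RUCFunctions

end

noncomputable section

/-! ### Functions on `G/H` and the Samuel compactification -/

section Samuel

theorem smul_base {G : Type*} [Group G] (H : Subgroup G) {h : G} (hh : h ∈ H) :
    h • ((1 : G) : G ⧸ H) = ((1 : G) : G ⧸ H) := by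
  rw [MulAction.Quotient.smul_coe, smul_eq_mul, mul_one]
  exact QuotientGroup.eq.2 (by simpa using hh)

variable {G : Type u} [Group G] [TopologicalSpace G]

theorem RUCb.ext {H : Subgroup G} {f f' : RUCb H}
    (h : ∀ x, (f : (G ⧸ H) →ᵇ ℂ) x = (f' : (G ⧸ H) →ᵇ ℂ) x) : f = f' :=
  Subtype.ext (BoundedContinuousFunction.ext h)

/-- The real part of the Gelfand transform. -/
def Sa.reGelfand (H : Subgroup G) : RUCb H →ₗ[ℝ] C(Sa H, ℝ) where
  toFun f := ⟨fun p => (p f).re, Complex.continuous_re.comp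
    ((WeakDual.eval_continuous f).comp continuous_subtype_val)⟩
  map_add' f f' := by ext p; simp
  map_smul' c f := by
    ext p
    change (p (c • f)).re = c * (p f).re
    have : c • f = (c : ℂ) • f := RUCb.ext fun x => rfl
    rw [this, map_smul, smul_eq_mul, Complex.re_ofReal_mul]

theorem Sa.reGelfand_point (H : Subgroup G) (f : RUCb H) (x : G ⧸ H) :
    Sa.reGelfand H f (Sa.point H x) = ((f : (G ⧸ H) →ᵇ ℂ) x).re := rfl

/-- By Gelfand duality a Urysohn function vanishing at all points of `G/H` is the transform of some
`f` in `RUC^b(G/H)`. Its values on `G/H` are then zero, so `f = 0`, and the Urysohn function cannot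
be `1` anywhere. -/
theorem Sa.denseRange_point (H : Subgroup G) : DenseRange (Sa.point H) := by
  intro p
  by_contra hp
  obtain ⟨F, hF0, hF1, -⟩ := exists_continuous_zero_one_of_isClosed
    (isClosed_closure (s := Set.range (Sa.point H))) (isClosed_singleton (x := p))
    (Set.disjoint_singleton_right.2 hp)
  obtain ⟨f, hf⟩ := (gelfandStarTransform (RUCb H)).surjective
    ⟨fun p => (F p : ℂ), Complex.continuous_ofReal.comp F.continuous⟩
  have hfp : ∀ p : Sa H, p f = (F p : ℂ) := fun p => by
    exact (gelfandStarTransform_apply_apply _ f p).symm.trans (DFunLike.congr_fun hf p)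
  have hf0 : f = 0 := RUCb.ext fun x => by
    have h1 : Sa.point H x f = (f : (G ⧸ H) →ᵇ ℂ) x := rfl
    rw [← h1, hfp, hF0 (subset_closure ⟨x, rfl⟩)]
    simp
  have := hfp p
  rw [hF1 rfl, hf0, map_zero] at this
  simp at this

variable [IsTopologicalGroup G]

theorem IsRUC.continuous {H : Subgroup G} {f : G ⧸ H → ℂ} (hf : IsRUC H f) : Continuous f := by
  rw [continuous_iff_continuousAt]
  intro x
  obtain ⟨g, rfl⟩ := QuotientGroup.mk_surjective x
  rw [ContinuousAt, Metric.tendsto_nhds]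
  intro ε hε
  obtain ⟨U, hU, h⟩ := hf ε hε
  rw [QuotientGroup.nhds_eq, eventually_map]
  have hc : Tendsto (fun y : G => y * g⁻¹) (𝓝 g) (𝓝 1) := by
    have : Continuous fun y : G => y * g⁻¹ := by fun_prop
    simpa using this.tendsto g
  filter_upwards [hc hU] with y hy
  have := h _ hy (g : G ⧸ H)
  rwa [← dist_eq_norm, MulAction.Quotient.smul_coe, smul_eq_mul, inv_mul_cancel_right] at this

/-- A bounded right uniformly continuous function as an element of `RUC^b(G/H)`. -/
def RUCb.mk {H : Subgroup G} (f : G ⧸ H → ℂ) {C : ℝ} (hC : ∀ x, ‖f x‖ ≤ C) (hf : IsRUC H f) :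
    RUCb H :=
  ⟨BoundedContinuousFunction.ofNormedAddCommGroup f hf.continuous C hC, hf⟩

/-- A right uniformly continuous function on `G` as an element of `RUC^b(G/⊥)`. -/
def rucLift (G : Type u) [Group G] [TopologicalSpace G] [IsTopologicalGroup G] :
    rucFun G →ₗ[ℝ] RUCb (⊥ : Subgroup G) where
  toFun f := RUCb.mk (C := f.2.1.choose) (fun x => (f.1 (QuotientGroup.quotientBot x) : ℂ))
    (fun x => by
      rw [Complex.norm_real]
      exact f.2.1.choose_spec _) fun ε hε => by
    obtain ⟨U, hU, h⟩ := f.2.2 ε hε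
    refine ⟨U, hU, fun u hu x => ?_⟩
    obtain ⟨g, rfl⟩ := QuotientGroup.mk_surjective x
    rw [← Complex.ofReal_sub, Complex.norm_real]
    exact h u hu g
  map_add' f f' := RUCb.ext fun x => Complex.ofReal_add _ _
  map_smul' c f := RUCb.ext fun x => Complex.ofReal_mul _ _

theorem rucLift_coe (f : rucFun G) (g : G) :
    (rucLift G f : (G ⧸ (⊥ : Subgroup G)) →ᵇ ℂ) (g : G ⧸ (⊥ : Subgroup G)) = f.1 g := rfl

theorem rucLift_translate {f f' : rucFun G} {h : G} (hf : ∀ g, f'.1 g = f.1 (h * g)) :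
    rucLift G f' = rucAction ⊥ h⁻¹ (rucLift G f) := by
  refine RUCb.ext fun x => ?_
  obtain ⟨g, rfl⟩ := QuotientGroup.mk_surjective x
  rw [rucAction_apply, inv_inv, MulAction.Quotient.smul_coe, smul_eq_mul, rucLift_coe, rucLift_coe,
    hf]

/-- Pullback of functions along `G/K → G/H` for `K ≤ H`. -/
def rucPullback {K H : Subgroup G} (hKH : K ≤ H) : RUCb H →⋆ₐ[ℂ] RUCb K where
  toFun f := RUCb.mk (C := ‖f‖) (fun x => (f : (G ⧸ H) →ᵇ ℂ) (Subgroup.quotientMapOfLE hKH x))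
    (fun x => (f : (G ⧸ H) →ᵇ ℂ).norm_coe_le_norm _) fun ε hε => by
    obtain ⟨U, hU, h⟩ := f.2 ε hε
    refine ⟨U, hU, fun u hu x => ?_⟩
    obtain ⟨g, rfl⟩ := QuotientGroup.mk_surjective x
    exact h u hu (g : G ⧸ H)
  map_one' := rfl
  map_mul' _ _ := rfl
  map_zero' := rfl
  map_add' _ _ := rfl
  commutes' _ := rfl
  map_star' _ := rfl

theorem rucPullback_rucAction {K H : Subgroup G} (hKH : K ≤ H) (g : G) (f : RUCb H) :
    rucPullback hKH (rucAction H g f) = rucAction K g (rucPullback hKH f) := by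
  refine RUCb.ext fun x => ?_
  obtain ⟨x, rfl⟩ := QuotientGroup.mk_surjective x
  rfl

/-- `H`-invariant functions in `RUC^b(G)` come from `RUC^b(G/H)`. -/
theorem exists_rucPullback_eq_rucLift (H : Subgroup G) (k : rucFun G)
    (hk : ∀ g, ∀ h ∈ H, k.1 (g * h) = k.1 g) :
    ∃ f : RUCb H, rucPullback bot_le f = rucLift G k ∧
      (f : (G ⧸ H) →ᵇ ℂ) ((1 : G) : G ⧸ H) = k.1 1 := by
  let k' : G ⧸ H → ℂ := Quotient.lift (fun g => (k.1 g : ℂ)) fun a b hab => by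
    have := hk a (a⁻¹ * b) (QuotientGroup.leftRel_apply.1 hab)
    rw [mul_inv_cancel_left] at this
    rw [this]
  obtain ⟨⟨C, hC⟩, hu⟩ := k.2
  refine ⟨RUCb.mk (C := C) k' (fun x => ?_) fun ε hε => ?_, RUCb.ext fun x => ?_, rfl⟩
  · obtain ⟨g, rfl⟩ := QuotientGroup.mk_surjective x
    exact (Complex.norm_real _).trans_le (hC g)
  · obtain ⟨U, hU, h⟩ := hu ε hε
    refine ⟨U, hU, fun u hu x => ?_⟩
    obtain ⟨g, rfl⟩ := QuotientGroup.mk_surjective x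
    change ‖(k.1 (u * g) : ℂ) - (k.1 g : ℂ)‖ < ε
    rw [← Complex.ofReal_sub, Complex.norm_real]
    exact h u hu g
  · obtain ⟨g, rfl⟩ := QuotientGroup.mk_surjective x
    rfl

/-- The map `Sa(G/K) → Sa(G/H)` for `K ≤ H`. -/
def Sa.map {K H : Subgroup G} (hKH : K ≤ H) : C(Sa K, Sa H) :=
  WeakDual.CharacterSpace.compContinuousMap (rucPullback hKH)

theorem Sa.map_apply {K H : Subgroup G} (hKH : K ≤ H) (p : Sa K) (f : RUCb H) :
    Sa.map hKH p f = p (rucPullback hKH f) := rfl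

theorem Sa.map_smul {K H : Subgroup G} (hKH : K ≤ H) (g : G) (p : Sa K) :
    Sa.map hKH (g • p) = g • Sa.map hKH p := by
  refine WeakDual.CharacterSpace.ext fun f => ?_
  rw [Sa.map_apply, Sa.smul_apply, Sa.smul_apply, Sa.map_apply, rucPullback_rucAction]

theorem Sa.denseRange_map {K H : Subgroup G} (hKH : K ≤ H) : DenseRange (Sa.map hKH) := by
  refine (Sa.denseRange_point H).mono ?_
  rintro _ ⟨x, rfl⟩
  obtain ⟨g, rfl⟩ := QuotientGroup.mk_surjective x
  exact ⟨Sa.point K (g : G ⧸ K), WeakDual.CharacterSpace.ext fun f => rfl⟩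

end Samuel

/-! ### Push-forward of measures -/

section PushForward

variable {X Y : Type u} [TopologicalSpace X] [CompactSpace X] [T2Space X] [TopologicalSpace Y]
  [CompactSpace Y] [T2Space Y]

/-- Precomposition with a continuous map, on spaces of continuous functions. -/
def precompC (q : C(X, Y)) : C(Y, ℝ) →L[ℝ] C(X, ℝ) :=
  { toFun := fun f => f.comp q
    map_add' := fun _ _ => rfl
    map_smul' := fun _ _ => rfl
    cont := ContinuousMap.continuous_precomp _ }

/-- Push-forward of regular probability measures. -/
def regProbMap (q : C(X, Y)) (Λ : RegProb X) : RegProb Y :=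
  ⟨(Λ : WeakDual ℝ C(X, ℝ)).comp (precompC q), by
    obtain ⟨h1, hpos⟩ := (mem_regProb_iff _).1 Λ.2
    exact (mem_regProb_iff _).2 ⟨h1, fun f hf => hpos _ fun x => hf (q x)⟩⟩

theorem regProbMap_apply (q : C(X, Y)) (Λ : RegProb X) (f : C(Y, ℝ)) :
    (regProbMap q Λ : WeakDual ℝ C(Y, ℝ)) f = (Λ : WeakDual ℝ C(X, ℝ)) (f.comp q) := rfl

theorem continuous_regProbMap (q : C(X, Y)) : Continuous (regProbMap q) :=
  Continuous.subtype_mk (WeakDual.continuous_of_continuous_eval fun f =>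
    (WeakDual.eval_continuous (f.comp q)).comp continuous_subtype_val) _

theorem preservesConvexComb_regProbMap (q : C(X, Y)) : PreservesConvexComb (regProbMap q) := by
  intro x y z a b _ _ _ h
  refine DFunLike.ext _ _ fun f => ?_
  change (z : WeakDual ℝ C(X, ℝ)) (f.comp q) =
    a • (x : WeakDual ℝ C(X, ℝ)) (f.comp q) + b • (y : WeakDual ℝ C(X, ℝ)) (f.comp q)
  rw [h]; rfl

/-- The image is closed and convex and contains the point masses on a dense set. -/
theorem regProbMap_surjective (q : C(X, Y)) (hq : DenseRange q) : Surjective (regProbMap q) := by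
  intro Λ
  have _ : CompactSpace (RegProb X) := isCompact_iff_compactSpace.1 regProb_isCompact
  have hcl : IsClosed (Set.range fun Λ => (regProbMap q Λ : WeakDual ℝ C(Y, ℝ))) :=
    (isCompact_range (continuous_subtype_val.comp (continuous_regProbMap q))).isClosed
  have hcv : Convex ℝ (Set.range fun Λ => (regProbMap q Λ : WeakDual ℝ C(Y, ℝ))) := by
    rintro _ ⟨μ, rfl⟩ _ ⟨ν, rfl⟩ a b ha hb hab
    exact ⟨⟨_, regProb_convex μ.2 ν.2 ha hb hab⟩,
      preservesConvexComb_regProbMap q μ ν _ a b ha hb hab rfl⟩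
  obtain ⟨μ, hμ⟩ := regProb_subset_of_pointMass_mem hq hcl hcv
    (fun x => ⟨pointMass x, rfl⟩) Λ.2
  exact ⟨μ, Subtype.ext hμ⟩

end PushForward

/-! ### Affine projectivity -/

section Projective

variable {G : Type u} [Group G] [TopologicalSpace G] [IsTopologicalGroup G]

/-- Restriction of an affine flow to a subgroup. -/
def AffineFlow.restrict (K : AffineFlow G) (H : Subgroup G) : AffineFlow H where
  E := K.E
  carrier := K.carrier
  nonempty := K.nonempty
  isCompact := K.isCompact
  convex := K.convex
  action := inferInstance
  continuous_action := inferInstance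
  affine_action h := K.affine_action h

/-- The lift is forced by its value at `δ_o`, which has to be an `H`-fixed point over `φ(δ_o)`. The
fixed point theorem supplies one, and barycenters extend its orbit map to all measures. -/
theorem isProjective_of_isAmenableTopGroup (H : Subgroup G) (hH : IsAmenableTopGroup H) :
    (probFlow G (Sa H)).IsProjective := by
  intro L P φ π hφ hπ hsurj
  let o : Sa H := Sa.point H ((1 : G) : G ⧸ H)
  have ho : ∀ h ∈ H, h • pointMass o = pointMass o := fun h hh => by
    rw [smul_pointMass, Sa.smul_point, smul_base H hh]
  have hp : ∃ p : P.carrier, π p = φ (pointMass o) ∧ ∀ h ∈ H, h • p = p := by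
    -- The fibre is `H`-invariant because `H` fixes `δ_o`, and nonempty because `π` is surjective.
    let S : Set P.E := Subtype.val '' {p : P.carrier | π p = φ (pointMass o)}
    have hS : (P.restrict H).IsSubflow S :=
      { subset := by rintro _ ⟨p, -, rfl⟩; exact p.2
        nonempty := by
          obtain ⟨p, hp⟩ := hsurj (φ (pointMass o))
          exact ⟨p.1, p, hp, rfl⟩
        isClosed := P.isCompact.isClosed.isClosedEmbedding_subtypeVal.isClosedMap _
          (isClosed_eq hπ.continuous continuous_const)
        convex := by
          rintro _ ⟨x, hx, rfl⟩ _ ⟨y, hy, rfl⟩ a b ha hb hab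
          refine ⟨⟨_, P.convex x.2 y.2 ha hb hab⟩, Subtype.ext ?_, rfl⟩
          rw [hπ.affine x y _ a b ha hb hab rfl, hx, hy, ← add_smul, hab, one_smul]
        smul_mem := by
          rintro h x ⟨y, hy, hyx⟩
          obtain rfl := Subtype.ext hyx
          refine ⟨(h : G) • y, ?_, rfl⟩
          change π ((h : G) • y) = _
          rw [hπ.equivariant, hy]
          exact (hφ.equivariant (h : G) (pointMass o)).symm.trans (congrArg φ (ho h h.2)) }
    obtain ⟨⟨_, p, hp, rfl⟩, hfix⟩ := AffineFlow.exists_fixed hH ((P.restrict H).subflow S hS)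
    exact ⟨p, hp, fun h hh => Subtype.ext (congrArg Subtype.val (hfix ⟨h, hh⟩) :)⟩
  obtain ⟨p, hpφ, hfix⟩ := hp
  let q : G ⧸ H → P.carrier := Quotient.lift (fun g : G => g • p) fun a b hab => by
    have := hfix (a⁻¹ * b) (QuotientGroup.leftRel_apply.1 hab)
    rw [mul_smul, inv_smul_eq_iff] at this
    exact this.symm
  have hq : ∀ (g : G) (x : G ⧸ H), q (g • x) = g • q x := by
    intro g x
    obtain ⟨y, rfl⟩ := QuotientGroup.mk_surjective x
    exact mul_smul g y p
  have _ : CompactSpace P.carrier := isCompact_iff_compactSpace.1 P.isCompact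
  -- Translates of a continuous function on the compact flow depend norm-continuously on the group
  -- element, so `ℓ ∘ q` is right uniformly continuous and extends to `Sa(G/H)`.
  have hc : ∀ ℓ : StrongDual ℝ P.E, ∃ f : RUCb H, ∀ x, (f : (G ⧸ H) →ᵇ ℂ) x = (ℓ (q x) : ℝ) := by
    intro ℓ
    let F : C(P.carrier, ℝ) := ⟨fun k => ℓ (k : P.E), by fun_prop⟩
    refine ⟨RUCb.mk (C := ‖F‖) (fun x => ((F (q x) : ℝ) : ℂ)) (fun x => ?_) fun ε hε => ?_,
      fun x => rfl⟩
    · rw [Complex.norm_real]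
      exact F.norm_coe_le_norm _
    · have h := (continuous_translateC (G := G) F).tendsto 1
      refine ⟨_, h (Metric.ball_mem_nhds _ hε), fun u hu x => ?_⟩
      have h1 : dist (translateC u F) (translateC (1 : G) F) < ε := hu
      have h2 := (ContinuousMap.dist_apply_le_dist (q x)).trans_lt h1
      rw [← Complex.ofReal_sub, Complex.norm_real, hq]
      simpa [translateC_apply, dist_eq_norm] using h2
  choose c hc using hc
  obtain ⟨b, hbc, hba, -, hb⟩ := exists_barycenter_map (Sa.denseRange_point H) P.isCompact P.convex
    q (fun ℓ => Sa.reGelfand H (c ℓ)) fun ℓ x => by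
      rw [Sa.reGelfand_point, hc, Complex.ofReal_re]
  have hbe : ∀ (g : G) (μ : RegProb (Sa H)), b (g • μ) = g • b μ := by
    intro g μ
    refine congrFun (regProb_map_ext (f := fun μ => b (g • μ)) (g := fun μ => g • b μ)
      (Sa.denseRange_point H) (hbc.comp (continuous_const_smul g)) (hbc.const_smul g)
      (hba.comp ((probFlow G (Sa H)).affine_action g))
      ((P.affine_action g).comp hba) fun x => ?_) μ
    simp only [smul_pointMass, Sa.smul_point, hb, hq]
  refine ⟨b, ⟨hbc, hbe, hba⟩, ?_⟩
  refine regProb_map_ext (Sa.denseRange_point H) (hπ.continuous.comp hbc) hφ.continuous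
    (hπ.affine.comp hba) hφ.affine fun x => ?_
  obtain ⟨g, rfl⟩ := QuotientGroup.mk_surjective x
  have h1 : pointMass (Sa.point H (g : G ⧸ H)) = g • pointMass o := by
    rw [smul_pointMass, Sa.smul_point, MulAction.Quotient.smul_coe, smul_eq_mul, mul_one]
  have h2 : φ (pointMass (Sa.point H (g : G ⧸ H))) = g • φ (pointMass o) := by
    rw [h1]
    exact hφ.equivariant g _
  refine Eq.trans ?_ h2.symm
  rw [← hpφ, ← hπ.equivariant]
  exact congrArg π (hb _)

/-- Lifting the identity gives an equivariant section `ψ` of `P(Sa(G)) → P(Sa(G/H))`. The measure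
`ψ(δ_o)` is `H`-invariant and lies over `δ_o`, so it is a mean over the base point. -/
theorem isAmenableTopGroup_of_isProjective [FirstCountableTopology G] (H : Subgroup G)
    (h : (probFlow G (Sa H)).IsProjective) : IsAmenableTopGroup H := by
  have hπ : IsAffineGMap (probFlow G (Sa (⊥ : Subgroup G))) (probFlow G (Sa H))
      (regProbMap (Sa.map bot_le)) :=
    { continuous := continuous_regProbMap _
      equivariant := fun g Λ => by
        refine Subtype.ext (DFunLike.ext _ _ fun f => ?_)
        refine congrArg
          (DFunLike.coe (F := WeakDual ℝ C(Sa (⊥ : Subgroup G), ℝ)) Λ.1) ?_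
        ext p
        exact congrArg f (Sa.map_smul bot_le g p)
      affine := preservesConvexComb_regProbMap _ }
  obtain ⟨ψ, hψ, hπψ⟩ := h (probFlow G (Sa H)) (probFlow G (Sa (⊥ : Subgroup G))) id _
    ⟨continuous_id, fun _ _ => rfl, fun _ _ _ _ _ _ _ _ h => h⟩ hπ
    (regProbMap_surjective _ (Sa.denseRange_map _))
  let o : Sa H := Sa.point H ((1 : G) : G ⧸ H)
  let Λ : RegProb (Sa (⊥ : Subgroup G)) := ψ (pointMass o)
  have hΛ : ∀ h ∈ H, h • Λ = Λ := fun h hh => by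
    refine (hψ.equivariant h (pointMass o)).symm.trans (congrArg ψ ?_)
    refine (smul_pointMass h o).trans ?_
    rw [Sa.smul_point, smul_base H hh]
  have hΛo : regProbMap (Sa.map bot_le) Λ = pointMass o := congrFun hπψ (pointMass o)
  refine isAmenableTopGroup_of_mean_over_point H
    ((Λ : WeakDual ℝ C(Sa (⊥ : Subgroup G), ℝ)).toLinearMap ∘ₗ Sa.reGelfand ⊥ ∘ₗ rucLift G)
    (fun f hf => ?_) (fun h hh f f' hff' => ?_) fun k hk => ?_
  · refine ((mem_regProb_iff _).1 Λ.2).2 _ fun p => ?_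
    refine (Sa.denseRange_point _).induction_on
      (p := fun p => 0 ≤ Sa.reGelfand ⊥ (rucLift G f) p) p
      (isClosed_le continuous_const (ContinuousMap.continuous _)) fun x => ?_
    obtain ⟨g, rfl⟩ := QuotientGroup.mk_surjective x
    exact hf g
  · change (Λ : WeakDual ℝ C(Sa (⊥ : Subgroup G), ℝ)) (Sa.reGelfand ⊥ (rucLift G f')) =
      (Λ : WeakDual ℝ C(Sa (⊥ : Subgroup G), ℝ)) (Sa.reGelfand ⊥ (rucLift G f))
    conv_rhs => rw [← hΛ h hh, regProb_smul_apply]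
    rw [rucLift_translate hff']
    rfl
  · obtain ⟨f, hf, hf1⟩ := exists_rucPullback_eq_rucLift H k hk
    change (Λ : WeakDual ℝ C(Sa (⊥ : Subgroup G), ℝ)) (Sa.reGelfand ⊥ (rucLift G k)) = k.1 1
    have h1 : Sa.reGelfand ⊥ (rucLift G k) = (Sa.reGelfand H f).comp (Sa.map bot_le) := by
      rw [← hf]; rfl
    rw [h1, ← regProbMap_apply, hΛo, pointMass_apply, Sa.reGelfand_point, hf1, Complex.ofReal_re]

end Projective

end

noncomputable section

/-! ### Positivity in function systems -/

section Positivity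

variable {A : Type*} [CommCStarAlgebra A]

theorem CStarPos.star_eq {x : A} (hx : CStarPos x) : star x = x := by
  obtain ⟨a, rfl⟩ := hx
  rw [star_mul, star_star]

theorem cstarPos_zero : CStarPos (0 : A) := ⟨0, by simp⟩

theorem CStarPos.add {x y : A} (hx : CStarPos x) (hy : CStarPos y) : CStarPos (x + y) := by
  let _ := CStarAlgebra.spectralOrder A
  have _ := CStarAlgebra.spectralOrderedRing A
  have h : ∀ z : A, CStarPos z ↔ 0 ≤ z := fun z =>
    CStarAlgebra.nonneg_iff_eq_star_mul_self.symm
  rw [h] at *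
  exact add_nonneg hx hy

theorem CStarPos.smul {x : A} (hx : CStarPos x) {c : ℝ} (hc : 0 ≤ c) : CStarPos ((c : ℂ) • x) := by
  obtain ⟨a, rfl⟩ := hx
  refine ⟨((√c : ℝ) : ℂ) • a, ?_⟩
  rw [star_smul, smul_mul_smul_comm, RCLike.star_def, Complex.conj_ofReal, ← Complex.ofReal_mul,
    Real.mul_self_sqrt hc]

theorem cstarPos_one : CStarPos (1 : A) := ⟨1, by simp⟩

theorem cstarPos_norm_smul_one_sub {x : A} (hx : star x = x) :
    CStarPos ((‖x‖ : ℂ) • (1 : A) - x) := by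
  let _ := CStarAlgebra.spectralOrder A
  have _ := CStarAlgebra.spectralOrderedRing A
  refine CStarAlgebra.nonneg_iff_eq_star_mul_self.1 (sub_nonneg.2 ?_)
  have := IsSelfAdjoint.le_algebraMap_norm_self (a := x) hx
  rwa [Algebra.algebraMap_eq_smul_one] at this

theorem cstarPos_boundedContinuousFunction_iff {X : Type*} [TopologicalSpace X] (f : X →ᵇ ℂ) :
    CStarPos f ↔ ∀ x, 0 ≤ (f x).re ∧ (f x).im = 0 := by
  constructor
  · rintro ⟨a, rfl⟩ x
    have : (star a * a : X →ᵇ ℂ) x = (Complex.normSq (a x) : ℂ) := by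
      rw [Complex.normSq_eq_conj_mul_self]; rfl
    rw [this]
    exact ⟨Complex.normSq_nonneg _, Complex.ofReal_im _⟩
  · intro h
    refine ⟨BoundedContinuousFunction.ofNormedAddCommGroup (fun x => ((√(f x).re : ℝ) : ℂ))
      (by fun_prop) (√‖f‖) (fun x => ?_), ?_⟩
    · rw [Complex.norm_real, Real.norm_eq_abs, abs_of_nonneg (Real.sqrt_nonneg _)]
      exact Real.sqrt_le_sqrt ((Complex.re_le_norm _).trans (f.norm_coe_le_norm x))
    · ext x
      change f x = (starRingEnd ℂ) ((√(f x).re : ℝ) : ℂ) * ((√(f x).re : ℝ) : ℂ)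
      rw [Complex.conj_ofReal, ← Complex.ofReal_mul, Real.mul_self_sqrt (h x).1]
      exact Complex.ext rfl (h x).2

end Positivity

/-! ### Real parts, the associated cone and states of a function system -/

namespace GFunctionSystem

variable {G : Type u} [Group G] [TopologicalSpace G]

/-- The unit of a function system. -/
def unit (E : GFunctionSystem G) : E.carrier := ⟨1, E.one_mem⟩

/-- The adjoint in a function system. -/
def conj (E : GFunctionSystem G) (x : E.carrier) : E.carrier := ⟨star (x : E.A), E.star_mem x x.2⟩

theorem coe_conj (E : GFunctionSystem G) (x : E.carrier) : (E.conj x : E.A) = star (x : E.A) := rfl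

/-- For self-adjoint `y` the element `‖y‖ 1 - y` is positive, so its image, and with it `φ y`, is
self-adjoint. The general case follows from the self-adjoint elements `x + x*` and `i (x - x*)`. -/
theorem map_conj {E F : GFunctionSystem G} (φ : E.carrier →ₗ[ℂ] F.carrier)
    (h1 : (φ E.unit : F.A) = 1)
    (hpos : ∀ x : E.carrier, CStarPos (x : E.A) → CStarPos (φ x : F.A)) (x : E.carrier) :
    φ (E.conj x) = F.conj (φ x) := by
  have hsa : ∀ y : E.carrier, E.conj y = y → F.conj (φ y) = φ y := by
    intro y hy
    have h2 := (hpos ((‖(y : E.A)‖ : ℂ) • E.unit - y)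
      (cstarPos_norm_smul_one_sub (congrArg Subtype.val hy))).star_eq
    rw [map_sub, map_smul, Submodule.coe_sub, Submodule.coe_smul, h1, star_sub, star_smul,
      star_one, RCLike.star_def, Complex.conj_ofReal] at h2
    exact Subtype.ext (sub_right_injective h2)
  have ha := congrArg Subtype.val (hsa (x + E.conj x) (Subtype.ext (by
    simp [coe_conj, add_comm])))
  have hb := congrArg Subtype.val (hsa (Complex.I • (x - E.conj x)) (Subtype.ext (by
    simp [coe_conj, ← smul_neg])))
  simp only [coe_conj, map_add, map_sub, map_smul, Submodule.coe_add, Submodule.coe_sub,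
    Submodule.coe_smul, star_add, star_smul, star_sub, RCLike.star_def, Complex.conj_I,
    neg_smul, ← smul_neg, neg_sub] at ha hb
  have hb' := smul_right_injective F.A Complex.I_ne_zero hb
  refine Subtype.ext ?_
  rw [coe_conj]
  have h2 : (2 : ℂ) • (φ (E.conj x) : F.A) = (2 : ℂ) • star (φ x : F.A) := by
    rw [two_smul, two_smul]
    linear_combination (exp := 1) -ha + hb'
  exact smul_right_injective F.A two_ne_zero h2

theorem ρ_conj (E : GFunctionSystem G) (g : G) (x : E.carrier) :
    E.ρ g (E.conj x) = E.conj (E.ρ g x) :=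
  map_conj (E.ρ g) (E.map_one g) (fun x => (E.pos_iff g x).1) x

/-- The cone of elements with positive real part. -/
def reCone (E : GFunctionSystem G) : PointedCone ℝ E.carrier where
  carrier := {x | CStarPos ((x + E.conj x : E.carrier) : E.A)}
  add_mem' {x y} hx hy := by
    have : ((x + y + E.conj (x + y) : E.carrier) : E.A) =
        ((x + E.conj x : E.carrier) : E.A) + ((y + E.conj y : E.carrier) : E.A) := by
      simp only [Submodule.coe_add, coe_conj, star_add]; abel
    change CStarPos _
    rw [this]
    exact CStarPos.add hx hy
  zero_mem' := by
    change CStarPos _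
    simpa [coe_conj] using cstarPos_zero
  smul_mem' c x hx := by
    have : ((c • x + E.conj (c • x) : E.carrier) : E.A) =
        ((c : ℝ) : ℂ) • ((x + E.conj x : E.carrier) : E.A) := by
      have h : ((c • x : E.carrier) : E.A) = ((c : ℝ) : ℂ) • (x : E.A) := rfl
      simp only [Submodule.coe_add, coe_conj, h, star_smul, RCLike.star_def, Complex.conj_ofReal,
        smul_add]
    change CStarPos _
    rw [this]
    exact CStarPos.smul hx c.2

theorem mem_reCone {E : GFunctionSystem G} {x : E.carrier} :
    x ∈ E.reCone ↔ CStarPos ((x + E.conj x : E.carrier) : E.A) := Iff.rfl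

theorem mem_reCone_of_cstarPos {E : GFunctionSystem G} {x : E.carrier}
    (hx : CStarPos (x : E.A)) : x ∈ E.reCone := by
  rw [mem_reCone, Submodule.coe_add, coe_conj, hx.star_eq]
  exact hx.add hx

theorem ρ_mem_reCone {E : GFunctionSystem G} (g : G) {x : E.carrier} (hx : x ∈ E.reCone) :
    E.ρ g x ∈ E.reCone := by
  rw [mem_reCone, ← ρ_conj, ← map_add]
  exact (E.pos_iff g _).1 hx

/-- With `z = x + x*`, twice the real part is `(‖z‖ 1 - z) + (2‖x‖ - ‖z‖) 1`, a sum of positive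
elements. This order-unit property gives the bound on states and the cofinality hypothesis of the
Riesz extension. -/
theorem norm_smul_unit_sub_mem_reCone {E : GFunctionSystem G} (x : E.carrier) :
    ‖x‖ • E.unit - x ∈ E.reCone := by
  set z : E.A := (x : E.A) + star (x : E.A) with hz
  have h1 := cstarPos_norm_smul_one_sub (x := z) (by rw [hz, star_add, star_star, add_comm])
  have h2 : 0 ≤ 2 * ‖x‖ - ‖z‖ := by
    have := norm_add_le (x : E.A) (star (x : E.A))
    rw [norm_star] at this
    rw [Submodule.coe_norm]
    linarith
  have h3 := h1.add (cstarPos_one.smul h2)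
  rw [mem_reCone]
  convert h3 using 1
  have h : ((‖x‖ • E.unit : E.carrier) : E.A) = (‖x‖ : ℂ) • (1 : E.A) := rfl
  rw [Submodule.coe_add, coe_conj, Submodule.coe_sub, h, star_sub, star_smul, star_one,
    RCLike.star_def, Complex.conj_ofReal, hz]
  push_cast
  module

/-- Real linear functionals that are positive on elements with positive real part. -/
structure IsReState (E : GFunctionSystem G) (t : E.carrier →ₗ[ℝ] ℝ) : Prop where
  map_unit : t E.unit = 1
  nonneg : ∀ x ∈ E.reCone, 0 ≤ t x

namespace IsReState

variable {E : GFunctionSystem G} {t : E.carrier →ₗ[ℝ] ℝ}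

theorem abs_le (ht : E.IsReState t) (x : E.carrier) : |t x| ≤ ‖x‖ := by
  have h : ∀ x, t x ≤ ‖x‖ := fun x => by
    have := ht.nonneg _ (norm_smul_unit_sub_mem_reCone x)
    rw [map_sub, map_smul, ht.map_unit, smul_eq_mul, mul_one] at this
    linarith
  refine abs_le'.2 ⟨h x, ?_⟩
  have := h (-x)
  rwa [map_neg, norm_neg] at this

/-- Both `i x` and `-i x` have real part zero, so both lie in the cone. This makes the
complexification of `t` real on self-adjoint elements. -/
theorem map_I_smul (ht : E.IsReState t) {x : E.carrier} (hx : E.conj x = x) :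
    t (Complex.I • x) = 0 := by
  have h : Complex.I • x + E.conj (Complex.I • x) = 0 := Subtype.ext (by
    have h' : star (x : E.A) = x := congrArg Subtype.val hx
    simp [coe_conj, h'])
  have h1 := ht.nonneg (Complex.I • x) (by
    rw [mem_reCone, h]
    exact cstarPos_zero)
  have h2 := ht.nonneg (-(Complex.I • x)) (by
    have : -(Complex.I • x) + E.conj (-(Complex.I • x)) = 0 := Subtype.ext (by
      have := congrArg Subtype.val h
      simp only [Submodule.coe_add, coe_conj, Submodule.coe_neg, star_neg, Submodule.coe_zero]
        at this ⊢
      rw [← neg_add, this, neg_zero])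
    rw [mem_reCone, this]
    exact cstarPos_zero)
  rw [map_neg] at h2
  linarith

theorem comp_ρ (ht : E.IsReState t) (g : G) :
    E.IsReState (t ∘ₗ (E.ρ g).restrictScalars ℝ) where
  map_unit := by
    have : E.ρ g E.unit = E.unit := Subtype.ext (E.map_one g)
    rw [LinearMap.comp_apply, LinearMap.restrictScalars_apply, this, ht.map_unit]
  nonneg x hx := ht.nonneg _ (ρ_mem_reCone g hx)

end IsReState

end GFunctionSystem

end

noncomputable section

/-! ### Injectivity of `RUC^b(G/H)` -/

section Injective

variable {G : Type u} [Group G] [TopologicalSpace G]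

/-! ### Invariant extensions of functionals -/

namespace GFunctionSystem

/-- The functionals in `IsReState` that extend a given functional along `ι`. -/
def reStateSet (E₁ E₂ : GFunctionSystem G) (ι : E₁.carrier →ₗ[ℂ] E₂.carrier)
    (s : E₁.carrier →ₗ[ℝ] ℝ) : Set (E₂.carrier → ℝ) :=
  {t | ∃ T : E₂.carrier →ₗ[ℝ] ℝ, E₂.IsReState T ∧ (∀ x, T (ι x) = s x) ∧ ∀ x, T x = t x}

variable {E₁ E₂ : GFunctionSystem G} {ι : E₁.carrier →ₗ[ℂ] E₂.carrier} {s : E₁.carrier →ₗ[ℝ] ℝ}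

theorem reStateSet_convex : Convex ℝ (reStateSet E₁ E₂ ι s) := by
  rintro t ⟨T, hT, hTs, hTt⟩ t' ⟨T', hT', hTs', hTt'⟩ a b ha hb hab
  refine ⟨a • T + b • T', ⟨?_, fun x hx => ?_⟩, fun x => ?_, fun x => ?_⟩
  · simp [hT.map_unit, hT'.map_unit, hab]
  · exact add_nonneg (mul_nonneg ha (hT.nonneg x hx)) (mul_nonneg hb (hT'.nonneg x hx))
  · simp [hTs, hTs', ← add_mul, hab]
  · simp [hTt, hTt']

theorem reStateSet_isCompact : IsCompact (reStateSet E₁ E₂ ι s) := by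
  refine (isCompact_univ_pi fun x : E₂.carrier =>
    isCompact_Icc (a := -‖x‖) (b := ‖x‖)).of_isClosed_subset ?_ ?_
  -- Each condition is closed for pointwise convergence, so Tychonoff's theorem for the box given by
  -- `|t x| ≤ ‖x‖` yields compactness.
  · have : reStateSet E₁ E₂ ι s = {t | (∀ x y, t (x + y) = t x + t y) ∧
        (∀ (c : ℝ) x, t (c • x) = c * t x) ∧ t E₂.unit = 1 ∧ (∀ x ∈ E₂.reCone, 0 ≤ t x) ∧
        ∀ x, t (ι x) = s x} := by
      ext t
      constructor
      · rintro ⟨T, hT, hTs, hTt⟩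
        obtain rfl : T = t := funext hTt
        exact ⟨map_add T, map_smul T, hT.map_unit, hT.nonneg, hTs⟩
      · rintro ⟨h1, h2, h3, h4, h5⟩
        exact ⟨⟨⟨t, h1⟩, h2⟩, ⟨h3, h4⟩, h5, fun _ => rfl⟩
    rw [this]
    refine IsClosed.and ?_ (IsClosed.and ?_ (IsClosed.and ?_ (IsClosed.and ?_ ?_)))
    · simp only [Set.ofPred_forall]
      exact isClosed_iInter fun x => isClosed_iInter fun y =>
        isClosed_eq (by fun_prop) (by fun_prop)
    · simp only [Set.ofPred_forall]
      exact isClosed_iInter fun x => isClosed_iInter fun y =>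
        isClosed_eq (by fun_prop) (by fun_prop)
    · exact isClosed_eq (by fun_prop) (by fun_prop)
    · simp only [Set.ofPred_forall]
      exact isClosed_iInter fun x => isClosed_iInter fun _ =>
        isClosed_le (by fun_prop) (by fun_prop)
    · simp only [Set.ofPred_forall]
      exact isClosed_iInter fun x => isClosed_eq (by fun_prop) (by fun_prop)
  · rintro t ⟨T, hT, -, hTt⟩ x -
    rw [← hTt]
    exact abs_le.1 (hT.abs_le x)

/-- Riesz extension along `ι`. The order embedding hypothesis ensures that `s` is nonnegative
wherever `ι` takes values in the cone of `E₂`. -/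
theorem reStateSet_nonempty (hι : IsGUnitalPositive E₁ E₂ ι)
    (hemb : ∀ x : E₁.carrier, CStarPos (ι x : E₂.A) → CStarPos (x : E₁.A))
    (hs : E₁.IsReState s) : (reStateSet E₁ E₂ ι s).Nonempty := by
  have h1 : ι E₁.unit = E₂.unit := Subtype.ext hι.map_one
  obtain ⟨T, hTs, hT⟩ := exists_nonneg_extension E₂.reCone (ι.restrictScalars ℝ) s
    (fun x hx => hs.nonneg x (hemb _ (by
      rw [map_add, map_conj ι hι.map_one hι.pos]
      exact hx)))
    (fun y => ⟨‖y‖ • E₁.unit, by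
      have h2 : ι.restrictScalars ℝ (‖y‖ • E₁.unit) = ‖y‖ • E₂.unit := by
        rw [map_smul, LinearMap.restrictScalars_apply, h1]
      have h3 := norm_smul_unit_sub_mem_reCone (-y)
      rw [norm_neg, sub_neg_eq_add] at h3
      rwa [h2]⟩)
  refine ⟨T, T, ⟨?_, hT⟩, hTs, fun _ => rfl⟩
  rw [← h1]
  exact (hTs _).trans hs.map_unit

/-- The action of `H` on the extensions of an `H`-invariant functional. -/
abbrev reStateAction (H : Subgroup G) (hι : IsGUnitalPositive E₁ E₂ ι)
    (hH : ∀ h ∈ H, ∀ x, s (E₁.ρ h x) = s x) : MulAction H (reStateSet E₁ E₂ ι s) where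
  smul := fun h t => ⟨fun x => t.1 (E₂.ρ (h : G)⁻¹ x), by
    obtain ⟨T, hT, hTs, hTt⟩ := t.2
    refine ⟨_, hT.comp_ρ (h : G)⁻¹, fun x => ?_, fun x => hTt _⟩
    rw [LinearMap.comp_apply, LinearMap.restrictScalars_apply, ← hι.equivariant, hTs,
      hH _ (H.inv_mem h.2)]⟩
  one_smul := fun t => Subtype.ext (funext fun x => by
    change t.1 (E₂.ρ ((1 : H) : G)⁻¹ x) = t.1 x
    simp)
  mul_smul := fun h h' t => Subtype.ext (funext fun x => by
    change t.1 (E₂.ρ ((h * h' : H) : G)⁻¹ x) = t.1 (E₂.ρ (h' : G)⁻¹ (E₂.ρ (h : G)⁻¹ x))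
    simp)

/-- The functionals in the set are uniformly `1`-Lipschitz, which turns norm continuity of the
action on `E₂` into joint continuity for pointwise convergence. -/
theorem continuousSMul_reStateAction [IsTopologicalGroup G] (H : Subgroup G)
    (hι : IsGUnitalPositive E₁ E₂ ι) (hH : ∀ h ∈ H, ∀ x, s (E₁.ρ h x) = s x) :
    letI := reStateAction H hι hH
    ContinuousSMul H (reStateSet E₁ E₂ ι s) := by
  let _ := reStateAction H hι hH
  refine ⟨Continuous.subtype_mk (continuous_pi fun x => ?_) _⟩
  change Continuous fun p : H × reStateSet E₁ E₂ ι s => p.2.1 (E₂.ρ (p.1 : G)⁻¹ x)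
  rw [continuous_iff_continuousAt]
  rintro ⟨h₀, t₀⟩
  have h1 : Tendsto (fun p : H × reStateSet E₁ E₂ ι s =>
      p.2.1 (E₂.ρ (p.1 : G)⁻¹ x) - p.2.1 (E₂.ρ (h₀ : G)⁻¹ x)) (𝓝 (h₀, t₀)) (𝓝 0) := by
    refine squeeze_zero_norm (a := fun p : H × reStateSet E₁ E₂ ι s =>
      ‖E₂.ρ (p.1 : G)⁻¹ x - E₂.ρ (h₀ : G)⁻¹ x‖) (fun p => ?_) ?_
    · obtain ⟨T, hT, -, hTt⟩ := p.2.2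
      rw [← hTt, ← hTt, ← map_sub]
      exact hT.abs_le _
    · have hc : Continuous fun p : H × reStateSet E₁ E₂ ι s =>
          ‖E₂.ρ (p.1 : G)⁻¹ x - E₂.ρ (h₀ : G)⁻¹ x‖ := by
        have h2 : Continuous fun p : H × reStateSet E₁ E₂ ι s => ((p.1 : G)⁻¹, x) := by fun_prop
        exact ((E₂.continuous_action.comp h2).sub continuous_const).norm
      simpa using hc.tendsto (h₀, t₀)
  have h2 : Tendsto (fun p : H × reStateSet E₁ E₂ ι s => p.2.1 (E₂.ρ (h₀ : G)⁻¹ x))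
      (𝓝 (h₀, t₀)) (𝓝 (t₀.1 (E₂.ρ (h₀ : G)⁻¹ x))) := by
    have : Continuous fun p : H × reStateSet E₁ E₂ ι s => p.2.1 (E₂.ρ (h₀ : G)⁻¹ x) :=
      (continuous_apply _).comp (continuous_subtype_val.comp continuous_snd)
    exact this.tendsto (h₀, t₀)
  simpa [ContinuousAt] using h1.add h2

/-- The extensions of an `H`-invariant functional form an affine `H`-flow. -/
def reStateFlow (H : Subgroup G) [IsTopologicalGroup G] (hι : IsGUnitalPositive E₁ E₂ ι)
    (hemb : ∀ x : E₁.carrier, CStarPos (ι x : E₂.A) → CStarPos (x : E₁.A))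
    (hs : E₁.IsReState s) (hH : ∀ h ∈ H, ∀ x, s (E₁.ρ h x) = s x) : AffineFlow H where
  E := E₂.carrier → ℝ
  carrier := reStateSet E₁ E₂ ι s
  nonempty := reStateSet_nonempty hι hemb hs
  isCompact := reStateSet_isCompact
  convex := reStateSet_convex
  action := reStateAction H hι hH
  continuous_action := continuousSMul_reStateAction H hι hH
  affine_action := by
    intro h x y z a b _ _ _ hz
    funext v
    exact congrFun hz (E₂.ρ (h : G)⁻¹ v)

/-- Invariant extension of invariant functionals, for amenable subgroups. -/
theorem exists_invariant_reState_extension [IsTopologicalGroup G] {H : Subgroup G}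
    (hamen : IsAmenableTopGroup H) (hι : IsGUnitalPositive E₁ E₂ ι)
    (hemb : ∀ x : E₁.carrier, CStarPos (ι x : E₂.A) → CStarPos (x : E₁.A))
    (hs : E₁.IsReState s) (hH : ∀ h ∈ H, ∀ x, s (E₁.ρ h x) = s x) :
    ∃ T : E₂.carrier →ₗ[ℝ] ℝ, E₂.IsReState T ∧ (∀ x, T (ι x) = s x) ∧
      ∀ h ∈ H, ∀ x, T (E₂.ρ h x) = T x := by
  obtain ⟨⟨t, T, hT, hTs, hTt⟩, hfix⟩ :=
    AffineFlow.exists_fixed hamen (reStateFlow H hι hemb hs hH)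
  obtain rfl : (T : E₂.carrier → ℝ) = t := funext hTt
  refine ⟨T, hT, hTs, fun h hh x => ?_⟩
  have h1 : T (E₂.ρ ((⟨h, hh⟩⁻¹ : H) : G)⁻¹ x) = T x :=
    congrFun (congrArg Subtype.val (hfix ⟨h, hh⟩⁻¹) :) x
  simpa using h1

end GFunctionSystem

/-! ### The two implications for injectivity -/

variable [IsTopologicalGroup G]

/-- Evaluation at a point of `G/H`. -/
def rucEval (H : Subgroup G) (x : G ⧸ H) : (rucSystem H).carrier →ₗ[ℂ] ℂ where
  toFun f := DFunLike.coe (F := (G ⧸ H) →ᵇ ℂ) f.1 x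
  map_add' _ _ := rfl
  map_smul' _ _ := rfl

theorem rucEval_ext {H : Subgroup G} {f f' : (rucSystem H).carrier}
    (h : ∀ x, rucEval H x f = rucEval H x f') : f = f' :=
  Subtype.ext (BoundedContinuousFunction.ext h)

theorem rucEval_ρ (H : Subgroup G) (x : G ⧸ H) (g : G) (f : (rucSystem H).carrier) :
    rucEval H x ((rucSystem H).ρ g f) = rucEval H (g⁻¹ • x) f := rfl

theorem rucSystem_cstarPos_iff {H : Subgroup G} (f : (rucSystem H).carrier) :
    CStarPos (f : (rucSystem H).A) ↔ ∀ x, 0 ≤ (rucEval H x f).re ∧ (rucEval H x f).im = 0 :=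
  cstarPos_boundedContinuousFunction_iff _

/-- A morphism into `RUC^b(G/H)` is recovered by equivariance from the `H`-invariant functional
given by its value at `o`. So it suffices to extend that functional invariantly. -/
theorem isInjective_of_isAmenableTopGroup (H : Subgroup G) (hH : IsAmenableTopGroup H) :
    (rucSystem H).IsInjective := by
  intro E₁ E₂ ι φ hι hemb hφ
  let o : G ⧸ H := ((1 : G) : G ⧸ H)
  let s : E₁.carrier →ₗ[ℝ] ℝ :=
    Complex.reLm ∘ₗ (rucEval H o ∘ₗ φ).restrictScalars ℝ
  have hs_apply : ∀ x, s x = (rucEval H o (φ x)).re := fun _ => rfl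
  have hs : E₁.IsReState s := by
    refine ⟨?_, fun x hx => ?_⟩
    · have h1 : φ E₁.unit = (rucSystem H).unit := Subtype.ext hφ.map_one
      rw [hs_apply, h1]
      rfl
    · have h1 := ((rucSystem_cstarPos_iff _).1 (hφ.pos _ hx) o).1
      rw [map_add, GFunctionSystem.map_conj φ hφ.map_one hφ.pos, map_add, Complex.add_re] at h1
      have h2 : (rucEval H o ((rucSystem H).conj (φ x))).re = (rucEval H o (φ x)).re :=
        Complex.conj_re _
      rw [h2] at h1
      rw [hs_apply]
      linarith
  obtain ⟨T, hT, hTs, hTH⟩ := GFunctionSystem.exists_invariant_reState_extension hH hι hemb hs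
    fun h hh x => by
      rw [hs_apply, hφ.equivariant, rucEval_ρ, smul_base H (H.inv_mem hh)]
      rfl
  -- The complex functional with real part `T`. It inherits `H`-invariance and extends `x ↦
  -- φ(x)(o)`.
  let S : E₂.carrier →ₗ[ℂ] ℂ := Module.Dual.extendRCLike T
  have hS : ∀ x, S x = (T x : ℂ) - Complex.I * (T (Complex.I • x) : ℂ) := fun x =>
    Module.Dual.extendRCLike_apply T x
  have hSH : ∀ h ∈ H, ∀ x, S (E₂.ρ h x) = S x := fun h hh x => by
    rw [hS, hS, ← map_smul, hTH h hh, hTH h hh]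
  have hSι : ∀ x, S (ι x) = rucEval H o (φ x) := fun x => by
    rw [hS, ← map_smul, hTs, hTs, hs_apply, hs_apply, map_smul, map_smul, smul_eq_mul]
    apply Complex.ext <;> simp
  -- The factor `2` comes from bounding real and imaginary parts separately; only uniformity in `g`
  -- matters.
  have hSle : ∀ (g : G) x, ‖S (E₂.ρ g x)‖ ≤ 2 * ‖x‖ := fun g x => by
    have h1 := (hT.comp_ρ g).abs_le x
    have h2 := (hT.comp_ρ g).abs_le (Complex.I • x)
    rw [norm_smul, Complex.norm_I, one_mul] at h2
    simp only [LinearMap.comp_apply, LinearMap.restrictScalars_apply] at h1 h2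
    rw [hS, ← map_smul]
    refine (norm_sub_le _ _).trans ?_
    rw [norm_mul, Complex.norm_I, one_mul, Complex.norm_real, Complex.norm_real]
    simp only [Real.norm_eq_abs]
    linarith
  -- The Poisson transform of `x`; it is well defined on cosets by `H`-invariance of `S`.
  let f : E₂.carrier → G ⧸ H → ℂ := fun x => Quotient.lift (fun g : G => S (E₂.ρ g⁻¹ x))
    fun a b hab => by
      have := hSH (a⁻¹ * b) (QuotientGroup.leftRel_apply.1 hab) (E₂.ρ b⁻¹ x)
      rw [← this, ← Module.End.mul_apply, ← map_mul]
      congr 3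
      group
  have hf : ∀ x (g : G), f x (g : G ⧸ H) = S (E₂.ρ g⁻¹ x) := fun _ _ => rfl
  have hbd : ∀ x y, ‖f x y‖ ≤ 2 * ‖x‖ := fun x y => by
    obtain ⟨g, rfl⟩ := QuotientGroup.mk_surjective y
    exact hSle _ _
  have hact : ∀ x (u : G) y, f x (u • y) = f (E₂.ρ u⁻¹ x) y := fun x u y => by
    obtain ⟨g, rfl⟩ := QuotientGroup.mk_surjective y
    rw [MulAction.Quotient.smul_coe, smul_eq_mul, hf, hf, mul_inv_rev, map_mul,
      Module.End.mul_apply]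
  have hadd : ∀ x x' y, f (x + x') y = f x y + f x' y := fun x x' y => by
    obtain ⟨g, rfl⟩ := QuotientGroup.mk_surjective y
    rw [hf, hf, hf, map_add, map_add]
  have hsmul : ∀ (c : ℂ) x y, f (c • x) y = c * f x y := fun c x y => by
    obtain ⟨g, rfl⟩ := QuotientGroup.mk_surjective y
    rw [hf, hf, map_smul, map_smul, smul_eq_mul]
  have hruc : ∀ x, IsRUC H (f x) := by
    intro x ε hε
    have hc : Continuous fun u : G => ‖E₂.ρ u⁻¹ x - x‖ := by
      have h2 : Continuous fun u : G => (u⁻¹, x) := by fun_prop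
      exact ((E₂.continuous_action.comp h2).sub continuous_const).norm
    have h1 : Tendsto (fun u : G => ‖E₂.ρ u⁻¹ x - x‖) (𝓝 1) (𝓝 0) := by
      simpa using hc.tendsto 1
    refine ⟨_, h1 (Iio_mem_nhds (half_pos hε)), fun u hu y => ?_⟩
    have h2 : ‖E₂.ρ u⁻¹ x - x‖ < ε / 2 := hu
    have h3 : f x (u • y) - f x y = f (E₂.ρ u⁻¹ x - x) y := by
      rw [hact, sub_eq_iff_eq_add, ← hadd, sub_add_cancel]
    rw [h3]
    refine (hbd _ _).trans_lt ?_
    linarith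
  let ψ : E₂.carrier →ₗ[ℂ] (rucSystem H).carrier :=
    { toFun := fun x => RUCb.mk (f x) (hbd x) (hruc x)
      map_add' := fun x x' => rucEval_ext (hadd x x')
      map_smul' := fun c x => rucEval_ext (hsmul c x) }
  have hψ : ∀ x y, rucEval H y (ψ x) = f x y := fun _ _ => rfl
  have hreal : ∀ x : E₂.carrier, CStarPos (x : E₂.A) → 0 ≤ (S x).re ∧ (S x).im = 0 := by
    intro x hx
    have h1 : T (Complex.I • x) = 0 := hT.map_I_smul (Subtype.ext hx.star_eq)
    have h2 := hT.nonneg x (GFunctionSystem.mem_reCone_of_cstarPos hx)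
    rw [hS, h1]
    simpa using h2
  refine ⟨ψ, ⟨?_, fun x hx => (rucSystem_cstarPos_iff _).2 fun y => ?_, fun g x =>
    rucEval_ext fun y => ?_⟩, LinearMap.ext fun x => rucEval_ext fun y => ?_⟩
  · refine congrArg Subtype.val (a₂ := (rucSystem H).unit) (rucEval_ext fun y => ?_)
    obtain ⟨g, rfl⟩ := QuotientGroup.mk_surjective y
    change f E₂.unit (g : G ⧸ H) = 1
    have h1 : E₂.ρ g⁻¹ E₂.unit = E₂.unit := Subtype.ext (E₂.map_one _)
    have h2 := hT.map_I_smul (x := E₂.unit) (Subtype.ext (star_one _))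
    rw [hf, h1, hS, h2, hT.map_unit]
    simp
  · obtain ⟨g, rfl⟩ := QuotientGroup.mk_surjective y
    exact hreal _ ((E₂.pos_iff _ _).1 hx)
  · rw [rucEval_ρ, hψ, hψ, hact, inv_inv]
  · obtain ⟨g, rfl⟩ := QuotientGroup.mk_surjective y
    rw [LinearMap.comp_apply, hψ, hf, ← hι.equivariant, hSι, hφ.equivariant, rucEval_ρ, inv_inv,
      MulAction.Quotient.smul_coe, smul_eq_mul, mul_one]

/-- The pullback along `G → G/H` as a map of function systems. -/
def rucSystemPullback (H : Subgroup G) :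
    (rucSystem H).carrier →ₗ[ℂ] (rucSystem (⊥ : Subgroup G)).carrier :=
  ((rucPullback bot_le : RUCb H →⋆ₐ[ℂ] RUCb (⊥ : Subgroup G)) :
    RUCb H →ₐ[ℂ] RUCb (⊥ : Subgroup G)).toLinearMap

/-- Extending the identity along the pullback gives an equivariant positive projection of `RUC^b(G)`
onto `RUC^b(G/H)`. Followed by evaluation at `o`, it is an `H`-invariant mean over the base point.
-/
theorem isAmenableTopGroup_of_isInjective [FirstCountableTopology G] (H : Subgroup G)
    (h : (rucSystem H).IsInjective) : IsAmenableTopGroup H := by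
  let o : G ⧸ H := ((1 : G) : G ⧸ H)
  have hpos : ∀ f : (rucSystem H).carrier,
      CStarPos (f : (rucSystem H).A) ↔ CStarPos ((rucSystemPullback H f).1 : (rucSystem (⊥ : Subgroup G)).A) := by
    intro f
    rw [rucSystem_cstarPos_iff, rucSystem_cstarPos_iff, QuotientGroup.mk_surjective.forall,
      QuotientGroup.mk_surjective.forall]
    rfl
  obtain ⟨ψ, hψ, hψι⟩ := h (rucSystem H) (rucSystem ⊥) (rucSystemPullback H) LinearMap.id
    ⟨rfl, fun f => (hpos f).1, fun g f => rucPullback_rucAction bot_le g f⟩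
    (fun f => (hpos f).2) ⟨rfl, fun _ h => h, fun _ _ => rfl⟩
  let L : rucFun G →ₗ[ℝ] (rucSystem (⊥ : Subgroup G)).carrier := rucLift G
  let m : rucFun G →ₗ[ℝ] ℝ := Complex.reLm ∘ₗ (rucEval H o ∘ₗ ψ).restrictScalars ℝ ∘ₗ L
  have hm : ∀ f, m f = (rucEval H o (ψ (L f))).re := fun _ => rfl
  refine isAmenableTopGroup_of_mean_over_point H m (fun f hf => ?_) (fun h hh f f' hff' => ?_)
    fun k hk => ?_
  · refine ((rucSystem_cstarPos_iff _).1 (hψ.pos (L f)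
      ((rucSystem_cstarPos_iff _).2 fun x => ?_)) o).1
    obtain ⟨g, rfl⟩ := QuotientGroup.mk_surjective x
    exact ⟨hf g, Complex.ofReal_im _⟩
  · have h1 : L f' = (rucSystem ⊥).ρ h⁻¹ (L f) := rucLift_translate hff'
    rw [hm, hm, h1, hψ.equivariant, rucEval_ρ, inv_inv, smul_base H hh]
  · obtain ⟨f, hf, hf1⟩ := exists_rucPullback_eq_rucLift H k hk
    have h1 : L k = rucSystemPullback H f := hf.symm
    have h2 : ψ (rucSystemPullback H f) = f := LinearMap.congr_fun hψι f
    have h3 : rucEval H o f = k.1 1 := hf1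
    rw [hm, h1, h2, h3, Complex.ofReal_re]

end Injective

end

/-- For a closed subgroup `H` of a Polish group `G`: `H` is amenable iff `P(Sa(G/H))` is affine
`G`-projective, and iff `RUC^b(G/H)` is injective among `G`-function systems. -/
theorem mainTheorem2 {G : Type*} [Group G] [TopologicalSpace G] [IsTopologicalGroup G]
    [PolishSpace G] (H : Subgroup G) (hH : IsClosed (H : Set G)) :
    (IsAmenableTopGroup H ↔ (probFlow G (Sa H)).IsProjective) ∧
      (IsAmenableTopGroup H ↔ (rucSystem H).IsInjective) :=
  ⟨⟨isProjective_of_isAmenableTopGroup H, isAmenableTopGroup_of_isProjective H⟩,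
    isInjective_of_isAmenableTopGroup H, isAmenableTopGroup_of_isInjective H⟩
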